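/- Let $F$ be a field of characteristic not $2$, and fix a separable closure $\Omega$ of $F$; all extensions of $F$ are taken inside $\Omega$. For a field $K$ of characteristic not $2$ and $x\in K^\times$ write $[x]_K$ for the class of $x$ in $K^\times/(K^\times)^2$, regarded as an $\mathbb F_2$-vector space. If $F\subseteq K\subseteq\Omega$ and $S\subseteq K^\times/(K^\times)^2$, put $K(\sqrt S)=K(\sqrt s : [s]_K\in S)\subseteq\Omega$. For $a,b\in F^\times$ write $(a,b)=0$ if the quaternion algebra over $F$ with $i^2=a$, $j^2=b$, $ij=-ji$ is isomorphic to $M_2(F)$. Let $\mathbb U_4(\mathbb F_2)$ be the group of upper triangular $4\times4$ matrices over $\mathbb F_2$ with diagonal entries $1$, and let $E_{ij}=1+e_{ij}\in \mathbb U_4(\mathbb F_2)$ for $i<j$, where $e_{ij}$ is the matrix with entry $1$ in position $(i,j)$ and $0$ elsewhere. An *admissible triple* $([b]_F,V,W)$ consists of a class $[b]_F\in F^\times/(F^\times)^2$, an $\mathbb F_2$-subspace $V\subseteq F^\times/(F^\times)^2$ and, with $E=F(\sqrt V)$, an $\mathbb F_2[\mathrm{Gal}(E/F)]$-submodule $W\subseteq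 E^\times/(E^\times)^2$ such that 1. $\dim_{\mathbb F_2}V=2$, $\dim_{\mathbb F_2}\langle V,[b]_F\rangle=3$, and $(b,v)=0$ for every $[v]_F\in V$; 2. $W$ is a free $\mathbb F_2[\mathrm{Gal}(E/F)]$-module, generated by one element $[\delta]_E$, $\delta\in E^\times$, with $[\mathrm{Nm}_{E/F}(\delta)]_F=[b]_F$. A *Galois $\mathbb U_4(\mathbb F_2)$-extension* is a finite Galois extension $L/F$ (with $L\subseteq\Omega$) such that $\mathrm{Gal}(L/F)\simeq\mathbb U_4(\mathbb F_2)$. **Theorem.** There is a bijection from the set of admissible triples $([b]_F,V,W)$ onto the set of Galois $\mathbb U_4(\mathbb F_2)$-extensions $L/F$ with the following properties. (i) It sends $([b]_F,V,W)$ to $L=E(\sqrt W)=F(\sqrt V)(\sqrt W)$. (ii) Its inverse sends $L/F$ to the triple $([b]_F,V,W)$ obtained as follows, for any choice of an isomorphism $\rho:\mathrm{Gal}(L/F)\to\mathbb U_4(\mathbb F_2)$. Put $\sigma_1=\rho^{-1}(E_{12})$, $\sigma_2=\rho^{-1}(E_{23})$, $\sigma_3=\rho^{-1}(E_{34})$.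 There are $a,b,c\in F^\times$ with square roots in $L$ such that $\sigma_1$ negates $\sqrt a$ and fixes $\sqrt b,\sqrt c$; $\sigma_2$ negates $\sqrt b$ and fixes $\sqrt a,\sqrt c$; $\sigma_3$ negates $\sqrt c$ and fixes $\sqrt a,\sqrt b$. The first entry of the triple is the class $[b]_F$ of this $b$; $V=\langle[a]_F,[c]_F\rangle$; and, with $E=F(\sqrt V)$, $W=\{[w]_E : w\in E^\times,\ w\text{ is a square in }L\}$. In particular, this triple does not depend on $\rho$. -/

import Mathlib

open scoped Quaternion

universe u v

/-- The group `Kˣ / (Kˣ)²` of square classes of a field `K`, written additively, so that it can be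
regarded as a vector space over `𝔽₂`. -/
def SqClass (K : Type u) [Field K] : Type u :=
  Additive (Kˣ ⧸ (powMonoidHom 2 : Kˣ →* Kˣ).range)

noncomputable section

namespace SqClass

instance (K : Type u) [Field K] : AddCommGroup (SqClass K) :=
  inferInstanceAs (AddCommGroup (Additive (Kˣ ⧸ (powMonoidHom 2 : Kˣ →* Kˣ).range)))

/-- The square class `[x]_K` of `x ∈ Kˣ`, as a homomorphism. -/
def mk (K : Type u) [Field K] : Additive Kˣ →+ SqClass K :=
  MonoidHom.toAdditive (QuotientGroup.mk' (powMonoidHom 2 : Kˣ →* Kˣ).range)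

/-- The square class `[x]_K` of `x ∈ Kˣ`. -/
def of {K : Type u} [Field K] (x : Kˣ) : SqClass K := mk K (Additive.ofMul x)

theorem of_surjective {K : Type u} [Field K] (y : SqClass K) : ∃ x : Kˣ, of x = y :=
  QuotientGroup.mk_surjective (s := (powMonoidHom 2 : Kˣ →* Kˣ).range) y

theorem of_mul {K : Type u} [Field K] (x y : Kˣ) : of (x * y) = of x + of y := rfl

theorem of_eq_zero_iff {K : Type u} [Field K] (x : Kˣ) : of x = 0 ↔ ∃ y : Kˣ, y ^ 2 = x :=
  QuotientGroup.eq_one_iff (N := (powMonoidHom 2 : Kˣ →* Kˣ).range) x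

theorem two_nsmul_eq_zero {K : Type u} [Field K] (y : SqClass K) : 2 • y = 0 := by
  obtain ⟨x, rfl⟩ := of_surjective y
  rw [two_nsmul, ← of_mul, of_eq_zero_iff]
  exact ⟨x, sq x⟩

instance (K : Type u) [Field K] : Module (ZMod 2) (SqClass K) :=
  AddCommGroup.zmodModule two_nsmul_eq_zero

/-- The map on square classes induced by a homomorphism of unit groups. -/
def map {K : Type u} {L : Type v} [Field K] [Field L] (f : Kˣ →* Lˣ) :
    SqClass K →ₗ[ZMod 2] SqClass L :=
  AddMonoidHom.toZModLinearMap 2 (MonoidHom.toAdditive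
    (QuotientGroup.map (powMonoidHom 2 : Kˣ →* Kˣ).range (powMonoidHom 2 : Lˣ →* Lˣ).range f (by
      rintro _ ⟨y, rfl⟩
      exact ⟨f y, by simp⟩)) : SqClass K →+ SqClass L)

theorem map_of {K : Type u} {L : Type v} [Field K] [Field L] (f : Kˣ →* Lˣ) (x : Kˣ) :
    map f (of x) = of (f x) := rfl

/-- The action of `Gal(E/F)` on `Eˣ / (Eˣ)²`. -/
def galRep (F : Type u) (E : Type v) [Field F] [Field E] [Algebra F E] :
    Representation (ZMod 2) Gal(E/F) (SqClass E) where
  toFun σ := map (Units.map (σ : E →* E))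
  map_one' := by
    ext y
    obtain ⟨x, rfl⟩ := of_surjective y
    rfl
  map_mul' σ τ := by
    ext y
    obtain ⟨x, rfl⟩ := of_surjective y
    rfl

/-- `Eˣ / (Eˣ)²` as a module over the group ring `𝔽₂[Gal(E/F)]`. -/
instance (F : Type u) (E : Type v) [Field F] [Field E] [Algebra F E] :
    Module (MonoidAlgebra (ZMod 2) Gal(E/F)) (SqClass E) :=
  Module.compHom (SqClass E) (galRep F E).asAlgebraHom.toRingHom

theorem single_smul_of {F : Type u} {E : Type v} [Field F] [Field E] [Algebra F E]
    (σ : Gal(E/F)) (x : Eˣ) :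
    (MonoidAlgebra.single σ (1 : ZMod 2)) • of x = of (Units.map (σ : E →* E) x) := by
  change (galRep F E).asAlgebraHom (MonoidAlgebra.single σ (1 : ZMod 2)) (of x) = _
  rw [Representation.asAlgebraHom_single_one]
  rfl

end SqClass

/-- For a set `S` of square classes of `K`, the subfield `K(√S) = K(√s : [s]_K ∈ S)` of the
extension `Ω` of `K`. -/
def sqrtField (K : Type u) (Ω : Type v) [Field K] [Field Ω] [Algebra K Ω] (S : Set (SqClass K)) :
    IntermediateField K Ω :=
  IntermediateField.adjoin K {y : Ω | ∃ s : Kˣ, SqClass.of s ∈ S ∧ y ^ 2 = algebraMap K Ω (s : K)}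

/-- `(a, b)_F = 0`: the quaternion algebra with `i² = a`, `j² = b`, `ij = -ji` is isomorphic to the
algebra of `2 × 2` matrices over `F`. -/
def QuaternionSplit {F : Type u} [Field F] (a b : F) : Prop :=
  Nonempty (ℍ[F, a, 0, b] ≃ₐ[F] Matrix (Fin 2) (Fin 2) F)

/-- Admissible pairs `([b]_F, V)`. -/
structure IsAdmissiblePair {F : Type u} [Field F] (β : SqClass F)
    (V : Submodule (ZMod 2) (SqClass F)) : Prop where
  finrank_eq_two : Module.finrank (ZMod 2) V = 2
  finrank_sup_eq_three :
    Module.finrank (ZMod 2) (V ⊔ Submodule.span (ZMod 2) {β} : Submodule (ZMod 2) (SqClass F)) = 3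
  split : ∀ b v : Fˣ, SqClass.of b = β → SqClass.of v ∈ V → QuaternionSplit (b : F) (v : F)

/-- Admissible triples `([b]_F, V, W)`; here `E = F(√V)` inside `Ω`. -/
structure AdmissibleTriple (F : Type u) (Ω : Type v) [Field F] [Field Ω] [Algebra F Ω] where
  /-- the square class `[b]_F` -/
  b : SqClass F
  /-- the subspace `V` of `Fˣ / (Fˣ)²` -/
  V : Submodule (ZMod 2) (SqClass F)
  /-- the `𝔽₂[Gal(E/F)]`-submodule `W` of `Eˣ / (Eˣ)²` -/
  W : Submodule
    (MonoidAlgebra (ZMod 2) Gal((sqrtField F Ω (V : Set (SqClass F)))/F))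
    (SqClass (sqrtField F Ω (V : Set (SqClass F))))
  isAdmissiblePair : IsAdmissiblePair b V
  free : Module.Free
    (MonoidAlgebra (ZMod 2) Gal((sqrtField F Ω (V : Set (SqClass F)))/F)) W
  exists_generator : ∃ δ : (sqrtField F Ω (V : Set (SqClass F)))ˣ,
    W = Submodule.span _ {SqClass.of δ} ∧ SqClass.of (Units.map (Algebra.norm F) δ) = b

namespace AdmissibleTriple

variable {F : Type u} {Ω : Type v} [Field F] [Field Ω] [Algebra F Ω]

/-- The field `E = F(√V)`. -/
abbrev E (t : AdmissibleTriple F Ω) : IntermediateField F Ω :=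
  sqrtField F Ω (t.V : Set (SqClass F))

/-- The field `E(√W) = F(√V)(√W)`, as an extension of `F`. -/
def field (t : AdmissibleTriple F Ω) : IntermediateField F Ω :=
  (sqrtField t.E Ω (t.W : Set (SqClass t.E))).restrictScalars F

end AdmissibleTriple

/-- The group `𝕌ₙ(R)` of upper triangular `n × n` matrices over `R` with diagonal entries `1`. -/
def Unitriangular (n : ℕ) (R : Type u) [CommRing R] : Subgroup (GL (Fin n) R) where
  carrier := {M | (∀ i j, j < i → (M : Matrix (Fin n) (Fin n) R) i j = 0) ∧
    ∀ i, (M : Matrix (Fin n) (Fin n) R) i i = 1}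
  one_mem' := ⟨fun i j h => by simp [Matrix.one_apply_ne h.ne'], fun i => by simp⟩
  mul_mem' := by
    rintro A B ⟨hA, hA'⟩ ⟨hB, hB'⟩
    refine ⟨fun i j h => ?_, fun i => ?_⟩
    · rw [Units.val_mul, Matrix.mul_apply]
      refine Finset.sum_eq_zero fun k _ => ?_
      rcases lt_or_ge k i with hk | hk
      · rw [hA i k hk, zero_mul]
      · rw [hB k j (h.trans_le hk), mul_zero]
    · rw [Units.val_mul, Matrix.mul_apply, Finset.sum_eq_single i, hA', hB', one_mul]
      · intro k _ hk
        rcases lt_or_gt_of_ne hk with hk | hk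
        · rw [hA i k hk, zero_mul]
        · rw [hB k i hk, mul_zero]
      · simp
  inv_mem' := by
    rintro A ⟨hA, hA'⟩
    have hT : Matrix.BlockTriangular (A : Matrix (Fin n) (Fin n) R) id := fun i j h => hA i j h
    have : Invertible (A : Matrix (Fin n) (Fin n) R) := A.invertible
    have hB : ∀ i j, j < i → ((A⁻¹ : GL (Fin n) R) : Matrix (Fin n) (Fin n) R) i j = 0 := by
      intro i j h
      rw [Matrix.coe_units_inv]
      exact Matrix.blockTriangular_inv_of_blockTriangular hT h
    refine ⟨hB, fun i => ?_⟩
    have h1 : ((A : Matrix (Fin n) (Fin n) R) * ((A⁻¹ : GL (Fin n) R) : Matrix (Fin n) (Fin n) R)) i i = 1 := by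
      rw [← Units.val_mul, mul_inv_cancel]; simp
    rw [Matrix.mul_apply, Finset.sum_eq_single i, hA', one_mul] at h1
    · exact h1
    · intro k _ hk
      rcases lt_or_gt_of_ne hk with hk | hk
      · rw [hA i k hk, zero_mul]
      · rw [hB k i hk, mul_zero]
    · simp

/-- The elementary matrix `E_{ij} = 1 + e_{ij}`, for `i < j`, as an element of `𝕌ₙ(R)`. -/
def elemUnitriangular {n : ℕ} (R : Type u) [CommRing R] (i j : Fin n) (h : i < j) :
    Unitriangular n R :=
  ⟨⟨Matrix.transvection i j 1, Matrix.transvection i j (-1),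
    by rw [Matrix.transvection_mul_transvection_same _ _ h.ne]; simp,
    by rw [Matrix.transvection_mul_transvection_same _ _ h.ne]; simp⟩, by
    refine ⟨fun k l hkl => ?_, fun k => ?_⟩
    · have : ¬ (i = k ∧ j = l) := by rintro ⟨rfl, rfl⟩; exact absurd h hkl.asymm
      simp [Matrix.transvection, Matrix.one_apply_ne hkl.ne', this]
    · have : ¬ (i = k ∧ j = k) := by rintro ⟨rfl, rfl⟩; exact absurd h (lt_irrefl _)
      simp [Matrix.transvection, this]⟩

/-- The finite Galois extensions `L/F` inside `Ω` with `Gal(L/F) ≃ 𝕌₄(𝔽₂)`. -/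
structure U4Extension (F : Type u) (Ω : Type v) [Field F] [Field Ω] [Algebra F Ω] where
  /-- the field `L` -/
  field : IntermediateField F Ω
  finiteDimensional : FiniteDimensional F field
  isGalois : IsGalois F field
  nonempty_mulEquiv : Nonempty (Gal(field/F) ≃* Unitriangular 4 (ZMod 2))

/-- The triple `t = ([b]_F, V, W)` is obtained from the extension `L/F` and the isomorphism
`ρ : Gal(L/F) ≃ 𝕌₄(𝔽₂)` by Kummer theory: with `σ₁, σ₂, σ₃` the elements of `Gal(L/F)`
corresponding to `E₁₂, E₂₃, E₃₄`, and `[a], [b], [c]` dual to `σ₁, σ₂, σ₃`,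
one has `V = ⟨[a], [c]⟩`, and `W` consists of the square classes of `E = F(√V)` that
become trivial in `L`. -/
structure IsKummerTriple {F : Type u} {Ω : Type v} [Field F] [Field Ω] [Algebra F Ω]
    (L : IntermediateField F Ω) (ρ : Gal(L/F) ≃* Unitriangular 4 (ZMod 2))
    (t : AdmissibleTriple F Ω) : Prop where
  exists_dual : ∃ (a b c : Fˣ) (ra rb rc : L),
    ra ^ 2 = algebraMap F L (a : F) ∧
    rb ^ 2 = algebraMap F L (b : F) ∧
    rc ^ 2 = algebraMap F L (c : F) ∧
    (let σ₁ := ρ.symm (elemUnitriangular (ZMod 2) (0 : Fin 4) 1 (by decide))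
     let σ₂ := ρ.symm (elemUnitriangular (ZMod 2) (1 : Fin 4) 2 (by decide))
     let σ₃ := ρ.symm (elemUnitriangular (ZMod 2) (2 : Fin 4) 3 (by decide))
     (σ₁ ra = -ra ∧ σ₁ rb = rb ∧ σ₁ rc = rc) ∧
     (σ₂ ra = ra ∧ σ₂ rb = -rb ∧ σ₂ rc = rc) ∧
     (σ₃ ra = ra ∧ σ₃ rb = rb ∧ σ₃ rc = -rc)) ∧
    t.b = SqClass.of b ∧
    t.V = Submodule.span (ZMod 2) {SqClass.of a, SqClass.of c}
  W_eq : (t.W : Set (SqClass t.E)) =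
    {ω | ∃ w : t.Eˣ, SqClass.of w = ω ∧ ∃ y ∈ L, y ^ 2 = ((w : t.E) : Ω)}

end

/-! The matrices in `𝕌₄(𝔽₂)` whose entries (1,2) and (3,4) vanish form a normal elementary abelian
subgroup `A` of order 16, complemented by the Klein four-group `G = ⟨E₁₂, E₃₄⟩`. As a `G`-module,
`A` is free of rank one over `𝔽₂[G]`, so `𝕌₄(𝔽₂)` is the wreath product of `ℤ/2` by `(ℤ/2)²`. The
theorem is the Kummer dual of this description, with `E` the fixed field of `A` and `W` dual to `A`.

From a triple to an extension: the trace of `[δ]_E` over `Gal(E/F)` is `[Nm δ]_E`, which is nonzero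
exactly when `[Nm δ]_F` lies outside `V`. Over `𝔽₂`, an element with nonzero trace generates a free
module, so `W` has 16 elements and `E(√W)` has degree 4 · 16 = 64. The Galois group permutes the
square roots of the four conjugates of `δ` up to sign. Recording the permutation and the signs
embeds it into `𝕌₄(𝔽₂)` (`homOfCocycle`), and counting makes the embedding an isomorphism.

From an extension to a triple (`exists_admissibleTriple_field_eq`): the entry (1,4) is a character
of `A`. An eigenvector `θ ∈ L` for it has `δ = θ² ∈ E`. The product of the conjugates of `θ` under
`G` is a square root of `Nm δ`; it is fixed by `E₁₂` and `E₃₄` and negated by `E₂₃`, so `[Nm δ] =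
[b]`. A norm from `E` is a norm from `F(√v)` for every `[v] ∈ V`, which gives `(b, v) = 0`. Finally
`E(√W) ⊆ L`, and degrees give equality.

Uniqueness (`eq_of_dualData`): if `L = E(√W)`, then `Gal(L/E)` is abelian and contains all
commutators of `Gal(L/F)`. Hence it centralises `E₁₃` and `E₂₄`, so it lies in `A`. This forces `√a,
√c ∈ E`, whence `V`; the same norm computation gives `[b]`, and Kummer theory gives `W`. As `ρ` is
arbitrary, this yields both injectivity and (ii).

Matrix entries are numbered from 0 in the code. -/

set_option linter.unusedSectionVars false

/-! ### Signs indexed by `ZMod 2` -/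

/-- `x` if `i = 0`, and `-x` if `i = 1`. -/
def zsign {A : Type*} [Neg A] (i : ZMod 2) (x : A) : A := if i = 0 then x else -x

section Sign

variable {A : Type*}

@[simp] theorem zsign_zero [Neg A] (x : A) : zsign 0 x = x := if_pos rfl

@[simp] theorem zsign_one [Neg A] (x : A) : zsign 1 x = -x := if_neg (by decide)

theorem ZMod.two_cases (i : ZMod 2) : i = 0 ∨ i = 1 := by revert i; decide

theorem zsign_zsign [AddGroup A] (i j : ZMod 2) (x : A) : zsign i (zsign j x) = zsign (i + j) x := by
  rcases i.two_cases with rfl | rfl <;> rcases j.two_cases with rfl | rfl <;>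
    simp [show (1 : ZMod 2) + 1 = 0 from rfl]

theorem zsign_sq [Ring A] (i : ZMod 2) (x : A) : zsign i x ^ 2 = x ^ 2 := by
  rcases i.two_cases with rfl | rfl <;> simp

theorem map_zsign {B G : Type*} [AddGroup A] [AddGroup B] [FunLike G A B] [AddMonoidHomClass G A B]
    (f : G) (i : ZMod 2) (x : A) : f (zsign i x) = zsign i (f x) := by
  rcases i.two_cases with rfl | rfl <;> simp

theorem neg_ne_self_of_two_ne_zero [Ring A] [NoZeroDivisors A] (h2 : (2 : A) ≠ 0) {x : A}
    (hx : x ≠ 0) : -x ≠ x := by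
  intro h
  have : 2 * x = 0 := by rw [two_mul]; nth_rewrite 1 [← h]; simp
  rcases mul_eq_zero.1 this with h | h <;> contradiction

theorem zsign_injective [Ring A] [NoZeroDivisors A] (h2 : (2 : A) ≠ 0) {x : A} (hx : x ≠ 0)
    {i j : ZMod 2} (h : zsign i x = zsign j x) : i = j := by
  have := neg_ne_self_of_two_ne_zero h2 hx
  rcases i.two_cases with rfl | rfl <;> rcases j.two_cases with rfl | rfl
  · rfl
  · exact absurd (by simpa using h.symm) this
  · exact absurd (by simpa using h) this
  · rfl

theorem exists_zsign_of_sq_eq [CommRing A] [NoZeroDivisors A] {x y : A} (h : y ^ 2 = x ^ 2) :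
    ∃ i, y = zsign i x := by
  rcases sq_eq_sq_iff_eq_or_eq_neg.1 h with h | h
  · exact ⟨0, by simpa using h⟩
  · exact ⟨1, by simpa using h⟩

end Sign

/-! ### Square classes -/

namespace SqClass

variable {K : Type u} [Field K]

theorem of_one : of (1 : Kˣ) = 0 := map_zero (mk K)

theorem neg_eq_self (y : SqClass K) : -y = y := by
  rw [neg_eq_iff_add_eq_zero, ← two_nsmul, two_nsmul_eq_zero]

theorem of_eq_of_iff (x y : Kˣ) : of x = of y ↔ ∃ z : Kˣ, x = y * z ^ 2 := by
  rw [← sub_eq_zero, sub_eq_add_neg, neg_eq_self, ← of_mul, of_eq_zero_iff]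
  constructor
  · rintro ⟨z, hz⟩
    exact ⟨z * y⁻¹, by ext; have := y.ne_zero; simp only [mul_pow, hz]; push_cast; field_simp⟩
  · rintro ⟨z, rfl⟩
    exact ⟨y * z, by rw [mul_pow, mul_right_comm, ← sq]⟩

theorem zmod_two_smul (i : ZMod 2) (y : SqClass K) : i • y = if i = 0 then 0 else y := by
  rcases i.two_cases with rfl | rfl <;> simp

end SqClass

/-! ### Kummer theory of exponent two -/

section Kummer

variable {K : Type u} {Ω : Type v} [Field K] [Field Ω] [Algebra K Ω]

theorem exists_sq_eq_algebraMap [IsSepClosed Ω] (h2 : (2 : Ω) ≠ 0) (x : Ω) : ∃ y : Ω, y ^ 2 = x :=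
  have : NeZero ((2 : ℕ) : Ω) := ⟨by exact_mod_cast h2⟩
  IsSepClosed.exists_pow_nat_eq x 2

theorem mem_sqrtField_of_sq_eq {S : Set (SqClass K)} {s : Kˣ} (hs : SqClass.of s ∈ S) {y : Ω}
    (hy : y ^ 2 = algebraMap K Ω s) : y ∈ sqrtField K Ω S :=
  IntermediateField.subset_adjoin K _ ⟨s, hs, hy⟩

theorem ne_zero_of_sq_eq_algebraMap {s : Kˣ} {y : Ω} (hy : y ^ 2 = algebraMap K Ω s) : y ≠ 0 := by
  rintro rfl
  rw [zero_pow two_ne_zero] at hy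
  exact s.ne_zero ((map_eq_zero _).1 hy.symm)

/-- Square roots of elements of the same square class are proportional. -/
theorem exists_eq_mul_of_of_eq_of {s t : Kˣ} (h : SqClass.of s = SqClass.of t) {x y : Ω}
    (hx : x ^ 2 = algebraMap K Ω s) (hy : y ^ 2 = algebraMap K Ω t) :
    ∃ z : Kˣ, x = algebraMap K Ω z * y := by
  obtain ⟨z, rfl⟩ := (SqClass.of_eq_of_iff _ _).1 h
  have : x ^ 2 = (algebraMap K Ω z * y) ^ 2 := by
    simp only [hx, mul_pow, hy, Units.val_mul, Units.val_pow_eq_pow_val, map_mul, map_pow, mul_comm]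
  rcases sq_eq_sq_iff_eq_or_eq_neg.1 this with h | h
  · exact ⟨z, h⟩
  · exact ⟨-z, by rw [h]; simp⟩

theorem of_eq_of_of_eq_mul {s t : Kˣ} {x y : Ω}
    (hx : x ^ 2 = algebraMap K Ω s) (hy : y ^ 2 = algebraMap K Ω t) {z : K}
    (h : x = algebraMap K Ω z * y) : SqClass.of s = SqClass.of t := by
  have hz : z ≠ 0 := by
    rintro rfl
    exact ne_zero_of_sq_eq_algebraMap hx (by simpa using h)
  refine (SqClass.of_eq_of_iff _ _).2 ⟨Units.mk0 z hz, Units.ext ?_⟩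
  apply (algebraMap K Ω).injective
  rw [← hx, h, mul_pow, hy]
  simp [mul_comm]

/-- Two automorphisms of `Ω` fixing `K` commute on `K(√S)`. -/
theorem commute_on_sqrtField {G : Type*} [Group G] [MulSemiringAction G Ω] (σ τ : G)
    (hσ : ∀ x : K, σ • algebraMap K Ω x = algebraMap K Ω x)
    (hτ : ∀ x : K, τ • algebraMap K Ω x = algebraMap K Ω x) {S : Set (SqClass K)} {y : Ω}
    (hy : y ∈ sqrtField K Ω S) : σ • τ • y = τ • σ • y := by
  induction hy using IntermediateField.adjoin_induction with
  | mem y hy =>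
    obtain ⟨s, -, hy⟩ := hy
    obtain ⟨i, hi⟩ := exists_zsign_of_sq_eq (y := σ • y) (x := y) (by rw [← smul_pow', hy, hσ])
    obtain ⟨j, hj⟩ := exists_zsign_of_sq_eq (y := τ • y) (x := y) (by rw [← smul_pow', hy, hτ])
    rcases i.two_cases with rfl | rfl <;> rcases j.two_cases with rfl | rfl <;> simp_all
  | algebraMap x => rw [hσ, hτ, hσ]
  | add x y _ _ hx hy => simp only [smul_add, hx, hy]
  | inv x _ hx => simp only [smul_inv'', hx]
  | mul x y _ _ hx hy => simp only [smul_mul', hx, hy]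

/-- An automorphism fixing `K` and the square roots of representatives of `S` fixes `K(√S)`. -/
theorem fixes_sqrtField {G : Type*} [Group G] [MulSemiringAction G Ω] (σ : G)
    (hσ : ∀ x : K, σ • algebraMap K Ω x = algebraMap K Ω x) {S : Set (SqClass K)}
    (hS : ∀ s : Kˣ, SqClass.of s ∈ S → ∀ y : Ω, y ^ 2 = algebraMap K Ω s → σ • y = y) {y : Ω}
    (hy : y ∈ sqrtField K Ω S) : σ • y = y := by
  induction hy using IntermediateField.adjoin_induction with
  | mem y hy => obtain ⟨s, hs, hy⟩ := hy; exact hS s hs y hy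
  | algebraMap x => exact hσ x
  | add x y _ _ hx hy => simp only [smul_add, hx, hy]
  | inv x _ hx => simp only [smul_inv'', hx]
  | mul x y _ _ hx hy => simp only [smul_mul', hx, hy]

/-- The generating set is Galois-stable: a conjugate of a square root of `s ∈ K` is again a square
root of `s`. -/
theorem isGalois_sqrtField [IsGalois K Ω] (S : Set (SqClass K)) : IsGalois K (sqrtField K Ω S) := by
  have : Normal K (sqrtField K Ω S) := by
    rw [IntermediateField.normal_iff_forall_map_le]
    intro σ
    rw [sqrtField, IntermediateField.adjoin_map]
    apply IntermediateField.adjoin.mono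
    rintro _ ⟨y, ⟨s, hs, hy⟩, rfl⟩
    exact ⟨s, hs, by rw [← map_pow, hy, AlgHom.commutes]⟩
  exact ⟨⟩

/-- Square roots, in a Galois extension, of elements of distinct square classes are linearly
independent. -/
theorem linearIndependent_sqrt {M : Type*} [Field M] [Algebra K M] [IsGalois K M] {ι : Type*}
    (s : ι → Kˣ) (hs : Function.Injective fun i => SqClass.of (s i)) (y : ι → M)
    (hy : ∀ i, y i ^ 2 = algebraMap K M (s i)) : LinearIndependent K y := by
  have hy0 : ∀ i, y i ≠ 0 := fun i => ne_zero_of_sq_eq_algebraMap (hy i)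
  have hmul : ∀ i (σ τ : Gal(M/K)), σ (τ (y i)) / y i = σ (y i) / y i * (τ (y i) / y i) := by
    intro i σ τ
    obtain ⟨j, hj⟩ := exists_zsign_of_sq_eq (y := τ (y i)) (x := y i)
      (by rw [← map_pow, hy, AlgEquiv.commutes])
    have := hy0 i
    rw [hj, map_zsign]
    rcases j.two_cases with rfl | rfl <;> field_simp <;> simp
  -- These sign characters are distinct: if two agree, `y i / y j` is fixed, so the two classes
  -- agree. Applying `σ` to a relation among the `y i` gives a relation among the characters, which
  -- Dedekind's theorem excludes.
  let χ : ι → (Gal(M/K) →* M) := fun i =>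
    { toFun := fun σ => σ (y i) / y i
      map_one' := div_self (hy0 i)
      map_mul' := hmul i }
  have hχ : Function.Injective χ := by
    intro i j hij
    have h : ∀ σ : Gal(M/K), σ (y i / y j) = y i / y j := by
      intro σ
      have : σ (y i) / y i = σ (y j) / y j := DFunLike.congr_fun hij σ
      have h1 := hy0 i
      have h2 := hy0 j
      have h3 : σ (y j) ≠ 0 := by simpa using h2
      rw [map_div₀, div_eq_div_iff h3 h2]
      rw [div_eq_div_iff h1 h2] at this
      rw [this, mul_comm]
    obtain ⟨z, hz⟩ := (InfiniteGalois.mem_range_algebraMap_iff_fixed _).2 h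
    exact hs (of_eq_of_of_eq_mul (hy i) (hy j) (by rw [hz, div_mul_cancel₀ _ (hy0 j)]))
  have hD := (linearIndependent_monoidHom Gal(M/K) M).comp χ hχ
  rw [linearIndependent_iff'] at hD ⊢
  intro t c hc i hi
  have := hD t (fun i => algebraMap K M (c i) * y i) (by
    ext σ
    have := congrArg σ hc
    rw [map_sum, map_zero] at this
    simp only [Finset.sum_apply, Pi.smul_apply, Function.comp, smul_eq_mul, Pi.zero_apply]
    rw [← this]
    refine Finset.sum_congr rfl fun i _ => ?_
    change _ * (σ (y i) / y i) = _
    have := hy0 i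
    rw [Algebra.smul_def, map_mul, AlgEquiv.commutes]
    field_simp) i hi
  simpa [hy0 i] using this

variable [IsGalois K Ω]

/-- Since `S` is a subgroup, the square roots in question are closed under multiplication, so the
algebra they generate is merely their linear span. -/
theorem sqrtField_toSubmodule (S : AddSubgroup (SqClass K)) :
    Subalgebra.toSubmodule (sqrtField K Ω (S : Set (SqClass K))).toSubalgebra =
      Submodule.span K {y : Ω | ∃ s : Kˣ, SqClass.of s ∈ S ∧ y ^ 2 = algebraMap K Ω (s : K)} := by
  rw [sqrtField, IntermediateField.adjoin_toSubalgebra, Algebra.adjoin_eq_span]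
  congr 1
  let T : Submonoid Ω :=
    { carrier := {y : Ω | ∃ s : Kˣ, SqClass.of s ∈ S ∧ y ^ 2 = algebraMap K Ω (s : K)}
      one_mem' := ⟨1, by rw [SqClass.of_one]; exact S.zero_mem, by simp⟩
      mul_mem' := by
        rintro x y ⟨s, hs, hx⟩ ⟨t, ht, hy⟩
        exact ⟨s * t, by rw [SqClass.of_mul]; exact S.add_mem hs ht, by simp [mul_pow, hx, hy]⟩ }
  exact congrArg SetLike.coe (Submonoid.closure_eq T)

variable [IsSepClosed Ω] (h2 : (2 : Ω) ≠ 0)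
include h2

/-- The main facts of Kummer theory of exponent two. -/
theorem kummer_sqrtField (S : AddSubgroup (SqClass K)) [Finite S] :
    FiniteDimensional K (sqrtField K Ω (S : Set (SqClass K))) ∧
    Module.finrank K (sqrtField K Ω (S : Set (SqClass K))) = Nat.card S ∧
    ∀ (w : Kˣ) (y : Ω), y ^ 2 = algebraMap K Ω w → y ∈ sqrtField K Ω (S : Set (SqClass K)) →
      SqClass.of w ∈ S := by
  have hgal := isGalois_sqrtField (Ω := Ω) (S : Set (SqClass K))
  set M := sqrtField K Ω (S : Set (SqClass K)) with hM
  choose r hr using fun x : SqClass K => SqClass.of_surjective x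
  choose q hq using fun x : K => exists_sq_eq_algebraMap h2 (algebraMap K Ω x)
  have hqM : ∀ i : S, q (r i) ∈ M := fun i =>
    mem_sqrtField_of_sq_eq (by rw [hr]; exact i.2) (hq _)
  let y : S → M := fun i => ⟨q (r i), hqM i⟩
  have hy : ∀ i, y i ^ 2 = algebraMap K M (r i) := fun i => Subtype.ext (hq _)
  have hli : LinearIndependent K y := linearIndependent_sqrt (fun i : S => r i)
    (fun i j h => Subtype.ext (by simpa only [hr] using h)) y hy
  have hspan : ⊤ ≤ Submodule.span K (Set.range y) := by
    intro x _
    have hx : (x : Ω) ∈ Subalgebra.toSubmodule M.toSubalgebra := x.2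
    have hx := (sqrtField_toSubmodule (Ω := Ω) S).le hx
    have hle : Submodule.span K
        {y : Ω | ∃ s : Kˣ, SqClass.of s ∈ S ∧ y ^ 2 = algebraMap K Ω (s : K)} ≤
        (Submodule.span K (Set.range y)).map M.val.toLinearMap := by
      rw [Submodule.span_le]
      rintro z ⟨s, hs, hz⟩
      obtain ⟨k, hk⟩ := exists_eq_mul_of_of_eq_of (t := r (SqClass.of s)) (hr _).symm hz (hq _)
      refine ⟨(k : K) • y ⟨_, hs⟩, Submodule.smul_mem _ _ (Submodule.subset_span ⟨_, rfl⟩), ?_⟩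
      rw [hk, Algebra.smul_def]
      rfl
    obtain ⟨x', hx', h⟩ := hle hx
    rwa [show x = x' from Subtype.ext h.symm]
  let B := Module.Basis.mk hli hspan
  have hfd : FiniteDimensional K M := Module.Basis.finiteDimensional_of_finite B
  have hfr : Module.finrank K M = Nat.card S := Module.finrank_eq_nat_card_basis B
  refine ⟨hfd, hfr, fun w z hz hzM => ?_⟩
  by_contra hw
  -- A class outside `S` with a square root in `M` would give `|S| + 1` independent elements in a
  -- space of dimension `|S|`.
  let s' : Option S → Kˣ := fun o => o.elim w (fun i => r i)
  let y' : Option S → M := fun o => o.elim ⟨z, hzM⟩ y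
  have := linearIndependent_sqrt s' (by
    rintro (_ | i) (_ | j) h
    · rfl
    · simp only [s', Option.elim, hr] at h
      exact absurd (h ▸ j.2) hw
    · simp only [s', Option.elim, hr] at h
      exact absurd (h ▸ i.2) hw
    · simp only [s', Option.elim, hr] at h
      rw [Subtype.ext h]) y' (by
    rintro (_ | i)
    · exact Subtype.ext hz
    · exact hy i)
  have h := this.cardinalMk_le_finrank
  rw [hfr, ← Nat.cast_card (α := Option S)] at h
  simp only [Finite.card_option] at h
  exact absurd (Nat.cast_le.1 h) (by omega)

end Kummer

/-! ### The group `𝕌₄(𝔽₂)` -/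

namespace Unitriangular

/-- The `(i, j)` entry of an element of `𝕌₄(𝔽₂)`. -/
def entry (i j : Fin 4) (M : Unitriangular 4 (ZMod 2)) : ZMod 2 :=
  (M.1 : Matrix (Fin 4) (Fin 4) (ZMod 2)) i j

theorem entry_of_lt (M : Unitriangular 4 (ZMod 2)) {i j : Fin 4} (h : j < i) : entry i j M = 0 :=
  M.2.1 i j h

theorem entry_self (M : Unitriangular 4 (ZMod 2)) (i : Fin 4) : entry i i M = 1 := M.2.2 i

variable (M N : Unitriangular 4 (ZMod 2))

theorem entry_mul (i j : Fin 4) :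
    entry i j (M * N) = entry i 0 M * entry 0 j N + entry i 1 M * entry 1 j N +
      entry i 2 M * entry 2 j N + entry i 3 M * entry 3 j N := by
  simp only [entry, Subgroup.coe_mul, Units.val_mul, Matrix.mul_apply, Fin.sum_univ_four]

theorem entry_zero_one_mul : entry 0 1 (M * N) = entry 0 1 M + entry 0 1 N := by
  rw [entry_mul, entry_self, entry_self, entry_of_lt N (by decide : (1 : Fin 4) < 2),
    entry_of_lt N (by decide : (1 : Fin 4) < 3)]
  ring

theorem entry_one_two_mul : entry 1 2 (M * N) = entry 1 2 M + entry 1 2 N := by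
  rw [entry_mul, entry_self, entry_self, entry_of_lt M (by decide : (0 : Fin 4) < 1),
    entry_of_lt N (by decide : (2 : Fin 4) < 3)]
  ring

theorem entry_two_three_mul : entry 2 3 (M * N) = entry 2 3 M + entry 2 3 N := by
  rw [entry_mul, entry_self, entry_self, entry_of_lt M (by decide : (0 : Fin 4) < 2),
    entry_of_lt M (by decide : (1 : Fin 4) < 2)]
  ring

theorem entry_zero_two_mul :
    entry 0 2 (M * N) = entry 0 2 M + entry 0 1 M * entry 1 2 N + entry 0 2 N := by
  rw [entry_mul, entry_self, entry_self, entry_of_lt N (by decide : (2 : Fin 4) < 3)]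
  ring

theorem entry_one_three_mul :
    entry 1 3 (M * N) = entry 1 3 M + entry 1 2 M * entry 2 3 N + entry 1 3 N := by
  rw [entry_mul, entry_self, entry_self, entry_of_lt M (by decide : (0 : Fin 4) < 1)]
  ring

theorem entry_zero_three_mul :
    entry 0 3 (M * N) =
      entry 0 3 M + entry 0 2 M * entry 2 3 N + entry 0 1 M * entry 1 3 N + entry 0 3 N := by
  rw [entry_mul, entry_self, entry_self]
  ring

theorem entry_one (i j : Fin 4) (h : i ≠ j) : entry i j 1 = 0 := Matrix.one_apply_ne h

variable {M N} in
theorem ext_entry (h01 : entry 0 1 M = entry 0 1 N) (h12 : entry 1 2 M = entry 1 2 N)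
    (h23 : entry 2 3 M = entry 2 3 N) (h02 : entry 0 2 M = entry 0 2 N)
    (h13 : entry 1 3 M = entry 1 3 N) (h03 : entry 0 3 M = entry 0 3 N) : M = N := by
  refine Subtype.ext (Units.ext ?_)
  ext i j
  change entry i j M = entry i j N
  rcases lt_trichotomy i j with h | rfl | h
  · fin_cases i <;> fin_cases j <;> first | assumption | exact absurd h (by decide)
  · rw [entry_self, entry_self]
  · rw [entry_of_lt M h, entry_of_lt N h]

/-- An element of `𝕌₄(𝔽₂)` from its entries. -/
noncomputable def ofEntries (a b c d e f : ZMod 2) : Unitriangular 4 (ZMod 2) :=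
  ⟨Matrix.GeneralLinearGroup.mk'' !![1, a, d, f; 0, 1, b, e; 0, 0, 1, c; 0, 0, 0, 1] (by
    rw [Matrix.det_of_isUpperTriangular]
    · simp [Fin.prod_univ_four]
    · intro i j h
      fin_cases i <;> fin_cases j <;> first | rfl | exact absurd h (by decide)), by
    constructor
    · intro i j h
      fin_cases i <;> fin_cases j <;> first | rfl | exact absurd h (by decide)
    · intro i
      fin_cases i <;> rfl⟩

section ofEntries
variable (a b c d e f : ZMod 2)
@[simp] theorem entry_zero_one_ofEntries : entry 0 1 (ofEntries a b c d e f) = a := rfl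
@[simp] theorem entry_one_two_ofEntries : entry 1 2 (ofEntries a b c d e f) = b := rfl
@[simp] theorem entry_two_three_ofEntries : entry 2 3 (ofEntries a b c d e f) = c := rfl
@[simp] theorem entry_zero_two_ofEntries : entry 0 2 (ofEntries a b c d e f) = d := rfl
@[simp] theorem entry_one_three_ofEntries : entry 1 3 (ofEntries a b c d e f) = e := rfl
@[simp] theorem entry_zero_three_ofEntries : entry 0 3 (ofEntries a b c d e f) = f := rfl
end ofEntries

theorem ofEntries_entry : ofEntries (entry 0 1 M) (entry 1 2 M) (entry 2 3 M) (entry 0 2 M)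
    (entry 1 3 M) (entry 0 3 M) = M :=
  ext_entry rfl rfl rfl rfl rfl rfl

/-- An upper bound suffices: it is always played against a field of degree exactly 64. -/
theorem card_le : Nat.card (Unitriangular 4 (ZMod 2)) ≤ 64 := by
  have := Nat.card_le_card_of_surjective
    (fun x : Fin 6 → ZMod 2 => ofEntries (x 0) (x 1) (x 2) (x 3) (x 4) (x 5))
    (fun M => ⟨![entry 0 1 M, entry 1 2 M, entry 2 3 M, entry 0 2 M, entry 1 3 M, entry 0 3 M],
      ofEntries_entry M⟩)
  simpa using this

instance : Finite (Unitriangular 4 (ZMod 2)) :=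
  Finite.of_surjective
    (fun x : Fin 6 → ZMod 2 => ofEntries (x 0) (x 1) (x 2) (x 3) (x 4) (x 5))
    (fun M => ⟨![entry 0 1 M, entry 1 2 M, entry 2 3 M, entry 0 2 M, entry 1 3 M, entry 0 3 M],
      ofEntries_entry M⟩)

/-- The elementary matrix `E₁₂`. -/
abbrev E12 : Unitriangular 4 (ZMod 2) := elemUnitriangular (ZMod 2) (0 : Fin 4) 1 (by decide)
/-- The elementary matrix `E₂₃`. -/
abbrev E23 : Unitriangular 4 (ZMod 2) := elemUnitriangular (ZMod 2) (1 : Fin 4) 2 (by decide)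
/-- The elementary matrix `E₃₄`. -/
abbrev E34 : Unitriangular 4 (ZMod 2) := elemUnitriangular (ZMod 2) (2 : Fin 4) 3 (by decide)

theorem E12_eq : E12 = ofEntries 1 0 0 0 0 0 := ext_entry rfl rfl rfl rfl rfl rfl
theorem E23_eq : E23 = ofEntries 0 1 0 0 0 0 := ext_entry rfl rfl rfl rfl rfl rfl
theorem E34_eq : E34 = ofEntries 0 0 1 0 0 0 := ext_entry rfl rfl rfl rfl rfl rfl

theorem ofEntries_mul (a b c d e f a' b' c' d' e' f' : ZMod 2) :
    ofEntries a b c d e f * ofEntries a' b' c' d' e' f' =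
      ofEntries (a + a') (b + b') (c + c') (d + a * b' + d') (e + b * c' + e')
        (f + d * c' + a * e' + f') := by
  apply ext_entry <;>
  simp [entry_zero_one_mul, entry_one_two_mul, entry_two_three_mul, entry_zero_two_mul,
    entry_one_three_mul, entry_zero_three_mul]

theorem ofEntries_zero : ofEntries 0 0 0 0 0 0 = 1 := ext_entry rfl rfl rfl rfl rfl rfl

/-- `E₁₂`, `E₂₃` and `E₃₄` generate `𝕌₄(𝔽₂)`. -/
theorem eq_top_of_elem_mem {H : Subgroup (Unitriangular 4 (ZMod 2))} (h1 : E12 ∈ H) (h2 : E23 ∈ H)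
    (h3 : E34 ∈ H) : H = ⊤ := by
  rw [E12_eq] at h1
  rw [E23_eq] at h2
  rw [E34_eq] at h3
  -- For involutions `x, y` the square `(xy)²` is the commutator; this produces `E₁₃`, `E₂₄` and
  -- then `E₁₄`.
  have h4 : ofEntries 0 0 0 1 0 0 ∈ H := by
    have := H.mul_mem (H.mul_mem h1 h2) (H.mul_mem h1 h2)
    simp only [ofEntries_mul] at this
    exact this
  have h5 : ofEntries 0 0 0 0 1 0 ∈ H := by
    have := H.mul_mem (H.mul_mem h2 h3) (H.mul_mem h2 h3)
    simp only [ofEntries_mul] at this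
    exact this
  have h6 : ofEntries 0 0 0 0 0 1 ∈ H := by
    have := H.mul_mem (H.mul_mem h1 h5) (H.mul_mem h1 h5)
    simp only [ofEntries_mul] at this
    exact this
  have key : ∀ (g : ZMod 2 → Unitriangular 4 (ZMod 2)), g 0 ∈ H → g 1 ∈ H → ∀ i, g i ∈ H := by
    intro g h0 h1 i
    rcases i.two_cases with rfl | rfl <;> assumption
  have h0 : ofEntries 0 0 0 0 0 0 ∈ H := by rw [ofEntries_zero]; exact H.one_mem
  rw [eq_top_iff]
  intro M _
  rw [← ofEntries_entry M]
  -- In the order 34, 24, 14, 23, 13, 12 all cross terms of `ofEntries_mul` vanish.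
  have := H.mul_mem (H.mul_mem (H.mul_mem (H.mul_mem (H.mul_mem
    (key (fun i => ofEntries 0 0 i 0 0 0) h0 h3 (entry 2 3 M))
    (key (fun i => ofEntries 0 0 0 0 i 0) h0 h5 (entry 1 3 M)))
    (key (fun i => ofEntries 0 0 0 0 0 i) h0 h6 (entry 0 3 M)))
    (key (fun i => ofEntries 0 i 0 0 0 0) h0 h2 (entry 1 2 M)))
    (key (fun i => ofEntries 0 0 0 i 0 0) h0 h4 (entry 0 2 M)))
    (key (fun i => ofEntries i 0 0 0 0 0) h0 h1 (entry 0 1 M))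
  simpa only [ofEntries_mul, zero_add, add_zero, zero_mul, mul_zero] using this

/-- The elements commuting with `E₁₃ = [E₁₂, E₂₃]` and `E₂₄ = [E₂₃, E₃₄]` are those of the normal
abelian subgroup of order `16`. -/
theorem entry_eq_zero_of_commute (h1 : Commute M (E12 * E23 * E12⁻¹ * E23⁻¹))
    (h2 : Commute M (E23 * E34 * E23⁻¹ * E34⁻¹)) :
    entry 0 1 M = 0 ∧ entry 2 3 M = 0 := by
  have e1 : E12 * E23 * E12⁻¹ * E23⁻¹ = ofEntries 0 0 0 1 0 0 := by
    rw [mul_inv_eq_iff_eq_mul, mul_inv_eq_iff_eq_mul, E12_eq, E23_eq]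
    simp only [ofEntries_mul]
    rfl
  have e2 : E23 * E34 * E23⁻¹ * E34⁻¹ = ofEntries 0 0 0 0 1 0 := by
    rw [mul_inv_eq_iff_eq_mul, mul_inv_eq_iff_eq_mul, E23_eq, E34_eq]
    simp only [ofEntries_mul]
    rfl
  rw [e1] at h1
  rw [e2] at h2
  have h1 := congrArg (entry 0 3) h1.eq
  have h2 := congrArg (entry 0 3) h2.eq
  simp only [entry_zero_three_mul] at h1 h2
  constructor
  · simpa [add_comm] using h2
  · simpa [add_comm] using h1.symm

/-- A twisted homomorphism into a wreath product, as a homomorphism into `𝕌₄(𝔽₂)`. -/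
noncomputable def homOfCocycle {Γ : Type*} [Group Γ] (p q : Γ → ZMod 2) (e : Γ → ZMod 2 → ZMod 2 → ZMod 2)
    (hp : ∀ σ τ, p (σ * τ) = p σ + p τ) (hq : ∀ σ τ, q (σ * τ) = q σ + q τ)
    (he : ∀ σ τ i j, e (σ * τ) i j = e σ i j + e τ (i + p σ) (j + q σ)) :
    Γ →* Unitriangular 4 (ZMod 2) :=
  -- The partial sums of `e σ` over `i`, over `j` and over both identify functions on `(ℤ/2)²` with
  -- the upper right 2 × 2 block of an element of `A`. The terms in `q σ` come from multiplying that
  -- element on the right by the block diagonal matrix with superdiagonal entries `p σ` and `q σ`.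
  MonoidHom.mk' (fun σ => ofEntries (p σ) (e σ 0 0 + e σ 1 0 + e σ 0 1 + e σ 1 1) (q σ)
    (e σ 1 0 + e σ 1 1) (e σ 0 1 + e σ 1 1 + q σ * (e σ 0 0 + e σ 1 0 + e σ 0 1 + e σ 1 1))
    (e σ 1 1 + q σ * (e σ 1 0 + e σ 1 1))) (by
    intro σ τ
    simp only [ofEntries_mul, hp, hq, he]
    generalize e σ 0 0 = a
    generalize e σ 0 1 = b
    generalize e σ 1 0 = c
    generalize e σ 1 1 = d
    have h11 : (1 : ZMod 2) + 1 = 0 := rfl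
    rcases (p σ).two_cases with h1 | h1 <;> rcases (q σ).two_cases with h2 | h2 <;>
    rcases (q τ).two_cases with h3 | h3 <;>
    simp only [h1, h2, h3, zero_add, add_zero, h11, zero_mul, one_mul, mul_zero, mul_one] <;>
    congr 1 <;> ring_nf <;> reduce_mod_char)

theorem homOfCocycle_eq_one_iff {Γ : Type*} [Group Γ] (p q : Γ → ZMod 2)
    (e : Γ → ZMod 2 → ZMod 2 → ZMod 2) (hp hq he) (σ : Γ) :
    homOfCocycle p q e hp hq he σ = 1 ↔ p σ = 0 ∧ q σ = 0 ∧ ∀ i j, e σ i j = 0 := by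
  change ofEntries _ _ _ _ _ _ = 1 ↔ _
  constructor
  · intro h
    have h1 := congrArg (entry 0 1) h
    have h2 := congrArg (entry 1 2) h
    have h3 := congrArg (entry 2 3) h
    have h4 := congrArg (entry 0 2) h
    have h5 := congrArg (entry 1 3) h
    have h6 := congrArg (entry 0 3) h
    rw [entry_one _ _ (by decide)] at h1 h2 h3 h4 h5 h6
    simp only [entry_zero_one_ofEntries, entry_one_two_ofEntries, entry_two_three_ofEntries,
      entry_zero_two_ofEntries, entry_one_three_ofEntries, entry_zero_three_ofEntries] at *
    simp only [h3, zero_mul, add_zero] at h5 h6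
    simp only [h6, add_zero] at h2 h4 h5
    simp only [h4, h5, add_zero] at h2
    refine ⟨h1, h3, fun i j => ?_⟩
    rcases i.two_cases with rfl | rfl <;> rcases j.two_cases with rfl | rfl <;> assumption
  · rintro ⟨h1, h2, h3⟩
    simp only [h1, h2, h3, add_zero, mul_zero]
    exact ofEntries_zero

end Unitriangular

/-! ### Split quaternion algebras -/

/-- If `b = x² - v y²`, the quaternion algebra `(b, v)` is split. -/
theorem quaternionSplit_of_eq {F : Type u} [Field F] (h2 : (2 : F) ≠ 0) {b v : F} (hb : b ≠ 0)
    (hv : v ≠ 0) {x y : F} (h : b = x ^ 2 - v * y ^ 2) : QuaternionSplit b v := by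
  -- In the basis `1, √v` of `F[√v]`, `j` is multiplication by `√v`, and `i` is conjugation followed
  -- by multiplication by `x + y√v`; hence `i²` is the norm `x² - v y² = b`.
  let B : QuaternionAlgebra.Basis (Matrix (Fin 2) (Fin 2) F) b 0 v :=
    { i := !![x, -(v * y); y, -x]
      j := !![0, v; 1, 0]
      k := !![-(v * y), x * v; -x, y * v]
      i_mul_i := by
        ext i j
        fin_cases i <;> fin_cases j <;> simp [Matrix.mul_apply, h] <;> ring
      j_mul_j := by
        ext i j
        fin_cases i <;> fin_cases j <;> simp [Matrix.mul_apply]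
      i_mul_j := by
        ext i j
        fin_cases i <;> fin_cases j <;> simp [Matrix.mul_apply]
      j_mul_i := by
        ext i j
        fin_cases i <;> fin_cases j <;> simp [Matrix.mul_apply] <;> ring }
  have hinj : Function.Injective B.liftHom := by
    rw [injective_iff_map_eq_zero]
    rintro ⟨α, β, γ, κ⟩ h0
    have h0 : algebraMap F _ α + β • B.i + γ • B.j + κ • B.k = 0 := h0
    have e00 := congrFun (congrFun h0 0) 0
    have e01 := congrFun (congrFun h0 0) 1
    have e10 := congrFun (congrFun h0 1) 0
    have e11 := congrFun (congrFun h0 1) 1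
    simp [B, Matrix.algebraMap_matrix_apply] at e00 e01 e10 e11
    have hα : α = 0 := by
      have : 2 * α = 0 := by linear_combination e00 + e11
      simpa [h2] using this
    have hγ : γ = 0 := by
      have : 2 * (v * γ) = 0 := by linear_combination e01 + v * e10
      simpa [h2, hv] using this
    subst hα hγ
    have hκ : κ = 0 := by
      have : b * κ = 0 := by rw [h]; linear_combination y * e00 - x * e10
      simpa [hb] using this
    subst hκ
    have hβ : β = 0 := by
      have : b * β = 0 := by rw [h]; linear_combination x * e00 - v * y * e10
      simpa [hb] using this
    subst hβ
    rfl
  have hfr : Module.finrank F ℍ[F, b, 0, v] = Module.finrank F (Matrix (Fin 2) (Fin 2) F) := by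
    rw [QuaternionAlgebra.finrank_eq_four, Module.finrank_matrix]
    simp
  exact ⟨AlgEquiv.ofBijective B.liftHom ⟨hinj,
    (LinearMap.injective_iff_surjective_of_finrank_eq_finrank (f := B.liftHom.toLinearMap) hfr).1
      hinj⟩⟩

/-! ### Group rings of Klein four-groups over `𝔽₂` -/

/-- An element of a module over `𝔽₂[G]`, `G = {1, s, t, st}`, is free if its trace is nonzero. -/
theorem smul_injective_of_trace_ne_zero {G A : Type*} [Group G] [AddCommGroup A]
    [Module (MonoidAlgebra (ZMod 2) G) A] (hA : ∀ a : A, a + a = 0) {s t : G}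
    (hs : s * s = 1) (ht : t * t = 1) (hst : s * t = t * s)
    (hG : ∀ g : G, g = 1 ∨ g = s ∨ g = t ∨ g = s * t) {m : A}
    (hm : m + MonoidAlgebra.single s (1 : ZMod 2) • m + MonoidAlgebra.single t (1 : ZMod 2) • m +
      MonoidAlgebra.single (s * t) (1 : ZMod 2) • m ≠ 0) :
    Function.Injective fun x : MonoidAlgebra (ZMod 2) G => x • m := by
  set S := MonoidAlgebra.single s (1 : ZMod 2) with hS
  set T := MonoidAlgebra.single t (1 : ZMod 2) with hT
  have hST' : MonoidAlgebra.single (s * t) (1 : ZMod 2) = S * T := by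
    simp [hS, hT, MonoidAlgebra.single_mul_single]
  rw [hST'] at hm
  have hSS : S * S = 1 := by
    rw [hS, MonoidAlgebra.single_mul_single, hs, one_mul, MonoidAlgebra.one_def]
  have hTT : T * T = 1 := by
    rw [hT, MonoidAlgebra.single_mul_single, ht, one_mul, MonoidAlgebra.one_def]
  have hTS : T * S = S * T := by
    rw [hS, hT, MonoidAlgebra.single_mul_single, MonoidAlgebra.single_mul_single, hst]
  have hSST : S * (S * T) = T := by rw [← mul_assoc, hSS, one_mul]
  have hTST : T * (S * T) = S := by rw [← mul_assoc, hTS, mul_assoc, hTT, mul_one]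
  have key : ∀ x : MonoidAlgebra (ZMod 2) G, ∃ a b c d : ZMod 2, x =
      MonoidAlgebra.single 1 a + MonoidAlgebra.single s b + MonoidAlgebra.single t c +
        MonoidAlgebra.single (s * t) d := by
    intro x
    induction x using MonoidAlgebra.induction_linear with
    | zero => exact ⟨0, 0, 0, 0, by simp⟩
    | add x y hx hy =>
      obtain ⟨a, b, c, d, rfl⟩ := hx
      obtain ⟨a', b', c', d', rfl⟩ := hy
      refine ⟨a + a', b + b', c + c', d + d', ?_⟩
      simp only [MonoidAlgebra.single_add]
      abel
    | single g r =>
      rcases hG g with rfl | rfl | rfl | rfl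
      · exact ⟨r, 0, 0, 0, by simp⟩
      · exact ⟨0, r, 0, 0, by simp⟩
      · exact ⟨0, 0, r, 0, by simp⟩
      · exact ⟨0, 0, 0, r, by simp⟩
  let f : MonoidAlgebra (ZMod 2) G →+ A := (smulAddHom _ A).flip m
  change Function.Injective f
  rw [injective_iff_map_eq_zero]
  intro x hx
  obtain ⟨a, b, c, d, rfl⟩ := key x
  have hx : (MonoidAlgebra.single 1 a + MonoidAlgebra.single s b + MonoidAlgebra.single t c +
    MonoidAlgebra.single (s * t) d) • m = 0 := hx
  have hcong := fun y : MonoidAlgebra (ZMod 2) G => congrArg (fun z => y • z) hx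
  have h1 := hcong S
  have h2 := hcong T
  have h3 := hcong (S * T)
  -- Every nonzero ideal of `𝔽₂[G]` contains `1 + s + t + st`. For each of the 15 nonzero `x`, a sum
  -- of translates of `x • m = 0` shows that the trace of `m` vanishes.
  rcases a.two_cases with rfl | rfl <;> rcases b.two_cases with rfl | rfl <;>
    rcases c.two_cases with rfl | rfl <;> rcases d.two_cases with rfl | rfl <;>
    simp only [← hS, ← hT, hST', MonoidAlgebra.single_zero, add_zero, zero_add, smul_zero, smul_smul,
      ← MonoidAlgebra.one_def, add_smul, one_smul, smul_add, mul_one, mul_assoc, hSS, hTT, hTS,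
      hSST, hTST] at hx h1 h2 h3 hm ⊢ <;>
    exfalso <;> apply hm <;>
    generalize S • m = m1 at * <;> generalize T • m = m2 at * <;> generalize (S * T) • m = m3 at *
  all_goals first
    | linear_combination (norm := module) hx + h1 + h2 + h3
    | linear_combination (norm := module) hx + h1 + h2 + h3 - hA m - hA m1 - hA m2 - hA m3
    | linear_combination (norm := module) hx + h2
    | linear_combination (norm := module) hx + h1
    | linear_combination (norm := module) hx

/-! ### Eigenvectors for sign characters -/

/-- The twisted trace `y ↦ ∑ ±h(y)`, with signs given by `χ`, takes values in the eigenspace and is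
nonzero by Dedekind's independence of automorphisms. Additivity of `χ` is asked only on `H`, because
the entry (0,3) is a character of `A` but not of the whole group. -/
theorem exists_eigenvector {F L : Type*} [Field F] [Field L] [Algebra F L] [FiniteDimensional F L]
    (H : Subgroup Gal(L/F)) (χ : Gal(L/F) → ZMod 2)
    (hχ : ∀ σ ∈ H, ∀ τ ∈ H, χ (σ * τ) = χ σ + χ τ) :
    ∃ x : L, x ≠ 0 ∧ ∀ σ ∈ H, σ x = zsign (χ σ) x := by
  classical
  have : Fintype H := Fintype.ofFinite H
  have hli := (linearIndependent_monoidHom L L).comp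
    (fun h : H => ((h : Gal(L/F)) : L →* L)) (by
      intro h h' hh
      exact Subtype.ext (AlgEquiv.ext fun x => DFunLike.congr_fun hh x))
  have hne : ∃ y : L, ∑ h : H, zsign (χ h) ((h : Gal(L/F)) y) ≠ 0 := by
    by_contra! hcon
    have := Fintype.linearIndependent_iff.1 hli (fun h => zsign (χ h) 1) (by
      ext y
      rw [Pi.zero_apply, ← hcon y, Finset.sum_apply]
      refine Finset.sum_congr rfl fun h _ => ?_
      change zsign _ 1 * (h : Gal(L/F)) y = _
      rcases (χ h).two_cases with h | h <;> simp [h]) 1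
    rcases (χ ((1 : H) : Gal(L/F))).two_cases with h | h <;> rw [h] at this <;> simp at this
  obtain ⟨y, hy⟩ := hne
  refine ⟨_, hy, fun σ hσ => ?_⟩
  rw [map_sum]
  have hz : zsign (χ σ) (∑ h : H, zsign (χ h) ((h : Gal(L/F)) y)) =
      ∑ h : H, zsign (χ σ) (zsign (χ h) ((h : Gal(L/F)) y)) := by
    rcases (χ σ).two_cases with h | h <;> simp [h]
  rw [hz, ← Equiv.sum_comp (Equiv.mulLeft (⟨σ, hσ⟩ : H))
    (fun h : H => zsign (χ σ) (zsign (χ h) ((h : Gal(L/F)) y)))]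
  refine Finset.sum_congr rfl fun h _ => ?_
  have hadd : ∀ i : ZMod 2, i + i = 0 := by decide
  rw [map_zsign, zsign_zsign]
  simp only [Equiv.coe_mulLeft, Subgroup.coe_mul]
  rw [hχ σ hσ h h.2, ← add_assoc, hadd, zero_add]
  rfl

/-! ### The Galois action on `Ω` and on square roots -/

section Galois

variable {F : Type u} {Ω : Type v} [Field F] [Field Ω] [Algebra F Ω] [IsGalois F Ω]

instance (S : Set (SqClass F)) : IsGalois F (sqrtField F Ω S) := isGalois_sqrtField S

theorem mem_of_forall_fixed (K : IntermediateField F Ω) {y : Ω}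
    (h : ∀ σ : Gal(Ω/F), (∀ x ∈ K, σ x = x) → σ y = y) : y ∈ K := by
  rw [← InfiniteGalois.fixedField_fixingSubgroup K, IntermediateField.mem_fixedField_iff]
  intro σ hσ
  exact h σ ((IntermediateField.mem_fixingSubgroup_iff _ _).1 hσ)

theorem coe_restrictNormalHom (K : IntermediateField F Ω) [Normal F K] (σ : Gal(Ω/F)) (x : K) :
    ((AlgEquiv.restrictNormalHom K σ x : K) : Ω) = σ x :=
  AlgEquiv.restrictNormal_commutes σ K x

theorem restrictNormalHom_eq_iff (K : IntermediateField F Ω) [Normal F K] (σ τ : Gal(Ω/F)) :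
    AlgEquiv.restrictNormalHom K σ = AlgEquiv.restrictNormalHom K τ ↔ ∀ x ∈ K, σ x = τ x := by
  constructor
  · intro h x hx
    rw [← coe_restrictNormalHom K σ ⟨x, hx⟩, h, coe_restrictNormalHom]
  · intro h
    ext x
    rw [coe_restrictNormalHom, coe_restrictNormalHom, h x x.2]

theorem exists_sign (h2 : (2 : Ω) ≠ 0) {a : Fˣ} {y : Ω} (hy : y ^ 2 = algebraMap F Ω a) :
    ∃ p : Gal(Ω/F) → ZMod 2, (∀ σ, σ y = zsign (p σ) y) ∧ ∀ σ τ, p (σ * τ) = p σ + p τ := by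
  have : ∀ σ : Gal(Ω/F), ∃ i, σ y = zsign i y := fun σ =>
    exists_zsign_of_sq_eq (by rw [← map_pow, hy, AlgEquiv.commutes])
  choose p hp using this
  refine ⟨p, hp, fun σ τ => zsign_injective h2 (ne_zero_of_sq_eq_algebraMap hy) ?_⟩
  rw [← hp, AlgEquiv.mul_apply, hp τ, map_zsign, hp σ, zsign_zsign, add_comm]

/-! ### Biquadratic extensions -/

variable (F Ω) in
/-- A presentation of the space `V` by square roots `ra`, `rc` of two elements whose classes form a
basis. -/
structure BiquadraticData (V : Submodule (ZMod 2) (SqClass F)) where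
  /-- first radicand -/
  a : Fˣ
  /-- second radicand -/
  c : Fˣ
  /-- first square root -/
  ra : Ω
  /-- second square root -/
  rc : Ω
  hra : ra ^ 2 = algebraMap F Ω a
  hrc : rc ^ 2 = algebraMap F Ω c
  span_eq : V = Submodule.span (ZMod 2) {SqClass.of a, SqClass.of c}
  finrank_eq : Module.finrank (ZMod 2) V = 2

section Kummer
variable [IsSepClosed Ω] (h2 : (2 : Ω) ≠ 0)
include h2

theorem exists_biquadraticData {V : Submodule (ZMod 2) (SqClass F)}
    (hV : Module.finrank (ZMod 2) V = 2) : Nonempty (BiquadraticData F Ω V) := by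
  have : Module.Finite (ZMod 2) V := Module.finite_of_finrank_pos (by omega)
  let B := Module.finBasisOfFinrankEq (ZMod 2) V hV
  obtain ⟨a, ha⟩ := SqClass.of_surjective (B 0 : SqClass F)
  obtain ⟨c, hc⟩ := SqClass.of_surjective (B 1 : SqClass F)
  obtain ⟨ra, hra⟩ := exists_sq_eq_algebraMap h2 (algebraMap F Ω a)
  obtain ⟨rc, hrc⟩ := exists_sq_eq_algebraMap h2 (algebraMap F Ω c)
  refine ⟨⟨a, c, ra, rc, hra, hrc, ?_, hV⟩⟩
  have h := congrArg (Submodule.map V.subtype) B.span_eq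
  rw [Submodule.map_span, Submodule.map_top, Submodule.range_subtype, ← Set.range_comp] at h
  rw [← h, ha, hc]
  congr 1
  ext x
  simp [Fin.exists_fin_two, eq_comm]

theorem kummer_of_finrank_eq_two {V : Submodule (ZMod 2) (SqClass F)}
    (hV : Module.finrank (ZMod 2) V = 2) :
    FiniteDimensional F (sqrtField F Ω (V : Set (SqClass F))) ∧
    Module.finrank F (sqrtField F Ω (V : Set (SqClass F))) = 4 ∧
    ∀ (w : Fˣ) (y : Ω), y ^ 2 = algebraMap F Ω w → y ∈ sqrtField F Ω (V : Set (SqClass F)) →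
      SqClass.of w ∈ V := by
  have : Module.Finite (ZMod 2) V := Module.finite_of_finrank_pos (by omega)
  have : Finite V := Module.finite_of_finite (ZMod 2)
  have : Finite V.toAddSubgroup := this
  have h := kummer_sqrtField (Ω := Ω) h2 V.toAddSubgroup
  have hc : Nat.card V.toAddSubgroup = 4 := by
    change Nat.card V = 4
    rw [Module.natCard_eq_pow_finrank (K := ZMod 2), hV]
    simp
  exact ⟨h.1, h.2.1.trans hc, h.2.2⟩

end Kummer

namespace BiquadraticData

variable {V : Submodule (ZMod 2) (SqClass F)} (D : BiquadraticData F Ω V)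
include D

theorem of_a_mem : SqClass.of D.a ∈ V := 
  D.span_eq.ge (Submodule.subset_span (Or.inl rfl))

theorem of_c_mem : SqClass.of D.c ∈ V := 
  D.span_eq.ge (Submodule.subset_span (Or.inr rfl))

theorem ra_mem : D.ra ∈ sqrtField F Ω (V : Set (SqClass F)) :=
  mem_sqrtField_of_sq_eq D.of_a_mem D.hra

theorem rc_mem : D.rc ∈ sqrtField F Ω (V : Set (SqClass F)) :=
  mem_sqrtField_of_sq_eq D.of_c_mem D.hrc

theorem ra_ne_zero : D.ra ≠ 0 := ne_zero_of_sq_eq_algebraMap D.hra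

theorem rc_ne_zero : D.rc ≠ 0 := ne_zero_of_sq_eq_algebraMap D.hrc

theorem fixes {σ : Gal(Ω/F)} (ha : σ D.ra = D.ra) (hc : σ D.rc = D.rc) {x : Ω}
    (hx : x ∈ sqrtField F Ω (V : Set (SqClass F))) : σ x = x := by
  refine fixes_sqrtField σ (fun x => σ.commutes x) ?_ hx
  intro s hs y hy
  change SqClass.of s ∈ V at hs
  obtain ⟨i, j, hij⟩ := Submodule.mem_span_pair.1 (D.span_eq.le hs)
  change σ y = y
  have key : ∀ (t : Fˣ) (z : Ω), z ^ 2 = algebraMap F Ω t → σ z = z → SqClass.of s = SqClass.of t →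
      σ y = y := by
    intro t z hz hσ hst
    obtain ⟨k, rfl⟩ := exists_eq_mul_of_of_eq_of hst hy hz
    rw [map_mul, hσ, AlgEquiv.commutes]
  rw [SqClass.zmod_two_smul, SqClass.zmod_two_smul] at hij
  rcases i.two_cases with rfl | rfl <;> rcases j.two_cases with rfl | rfl <;> simp at hij
  · exact key 1 1 (by simp) (map_one σ) (by rw [← hij, SqClass.of_one])
  · exact key _ _ D.hrc hc hij.symm
  · exact key _ _ D.hra ha hij.symm
  · refine key (D.a * D.c) (D.ra * D.rc) ?_ (by rw [map_mul, ha, hc])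
      (by rw [← hij, SqClass.of_mul])
    rw [mul_pow, D.hra, D.hrc, Units.val_mul, map_mul]

theorem eq_on {σ τ : Gal(Ω/F)} (ha : σ D.ra = τ D.ra) (hc : σ D.rc = τ D.rc) {x : Ω}
    (hx : x ∈ sqrtField F Ω (V : Set (SqClass F))) : σ x = τ x := by
  have : (τ⁻¹ * σ) x = x := D.fixes (by simp [ha]) (by simp [hc]) hx
  have h := congrArg τ this
  rwa [AlgEquiv.mul_apply, ← AlgEquiv.mul_apply, mul_inv_cancel] at h

variable [IsSepClosed Ω] (h2 : (2 : Ω) ≠ 0)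
include h2

/-- All sign patterns on `(ra, rc)` occur. -/
theorem exists_sign_pattern (i j : ZMod 2) :
    ∃ σ : Gal(Ω/F), σ D.ra = zsign i D.ra ∧ σ D.rc = zsign j D.rc := by
  obtain ⟨hfd, hfr, -⟩ := kummer_of_finrank_eq_two (Ω := Ω) h2 D.finrank_eq
  set E := sqrtField F Ω (V : Set (SqClass F))
  obtain ⟨p, hp, -⟩ := exists_sign h2 D.hra
  obtain ⟨q, hq, -⟩ := exists_sign h2 D.hrc
  choose l hl using AlgEquiv.restrictNormalHom_surjective (F := F) (K₁ := E) Ω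
  -- The four automorphisms of `E` inject into the four sign patterns.
  have hinj : Function.Injective fun g : Gal(E/F) => (p (l g), q (l g)) := by
    intro g g' h
    simp only [Prod.mk.injEq] at h
    rw [← hl g, ← hl g', restrictNormalHom_eq_iff]
    intro x hx
    exact D.eq_on (by rw [hp, hp, h.1]) (by rw [hq, hq, h.2]) hx
  have hbij := hinj.bijective_of_nat_card_le (by
    rw [IsGalois.card_aut_eq_finrank, hfr]; simp)
  obtain ⟨g, hg⟩ := hbij.2 (i, j)
  simp only [Prod.mk.injEq] at hg
  exact ⟨l g, by rw [hp, hg.1], by rw [hq, hg.2]⟩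


variable {s t : Gal(Ω/F)} (hsa : s D.ra = -D.ra) (hsc : s D.rc = D.rc) (hta : t D.ra = D.ra)
  (htc : t D.rc = -D.rc)

local notation "E" => sqrtField F Ω (V : Set (SqClass F))
local notation "res" => AlgEquiv.restrictNormalHom (F := F) (K₁ := Ω) (sqrtField F Ω (V : Set (SqClass F)))

omit [IsSepClosed Ω] h2 in
theorem res_eq_iff (σ τ : Gal(Ω/F)) :
    res σ = res τ ↔ σ D.ra = τ D.ra ∧ σ D.rc = τ D.rc := by
  rw [restrictNormalHom_eq_iff]
  exact ⟨fun h => ⟨h _ D.ra_mem, h _ D.rc_mem⟩, fun h x hx => D.eq_on h.1 h.2 hx⟩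

include hsa hsc hta htc

omit [IsSepClosed Ω] in
theorem gal_cases (g : Gal(E/F)) : g = 1 ∨ g = res s ∨ g = res t ∨ g = res s * res t := by
  obtain ⟨σ, rfl⟩ := AlgEquiv.restrictNormalHom_surjective (F := F) (K₁ := E) Ω g
  obtain ⟨p, hp, -⟩ := exists_sign h2 D.hra
  obtain ⟨q, hq, -⟩ := exists_sign h2 D.hrc
  rw [← map_one (AlgEquiv.restrictNormalHom (F := F) (K₁ := Ω) E), ← map_mul]
  simp only [D.res_eq_iff, hp σ, hq σ, AlgEquiv.mul_apply, hsa, hsc, hta, htc, AlgEquiv.one_apply,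
    map_neg]
  rcases (p σ).two_cases with h | h <;> rcases (q σ).two_cases with h' | h' <;> simp [h, h']

omit [IsSepClosed Ω] h2 in
theorem res_mul_self : res s * res s = 1 ∧ res t * res t = 1 ∧ res s * res t = res t * res s := by
  rw [← map_one (AlgEquiv.restrictNormalHom (F := F) (K₁ := Ω) E), ← map_mul, ← map_mul, ← map_mul,
    ← map_mul]
  simp only [D.res_eq_iff, AlgEquiv.mul_apply, hsa, hsc, hta, htc, AlgEquiv.one_apply,
    map_neg, neg_neg, and_self]

theorem norm_eq_prod (x : E) :
    algebraMap F E (Algebra.norm F x) = x * res s x * res t x * (res s * res t) x := by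
  classical
  obtain ⟨hfd, hfr, -⟩ := kummer_of_finrank_eq_two (Ω := Ω) h2 D.finrank_eq
  have hra := neg_ne_self_of_two_ne_zero h2 D.ra_ne_zero
  have hrc := neg_ne_self_of_two_ne_zero h2 D.rc_ne_zero
  have huniv : (Finset.univ : Finset Gal(E/F)) = {1, res s, res t, res s * res t} := by
    ext g
    simpa using D.gal_cases h2 hsa hsc hta htc g
  rw [Algebra.norm_eq_prod_automorphisms, huniv, Finset.prod_insert, Finset.prod_insert,
    Finset.prod_insert, Finset.prod_singleton]
  · simp only [AlgEquiv.one_apply]; ring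
  all_goals
    rw [← map_mul]
    try rw [← map_one (AlgEquiv.restrictNormalHom (F := F) (K₁ := Ω) E)]
    simp only [Finset.mem_insert, Finset.mem_singleton, D.res_eq_iff, AlgEquiv.mul_apply, hsa, hsc,
      hta, htc, AlgEquiv.one_apply, map_neg]
    simp [hra, hra.symm, hrc.symm]

/-- The form with lifts to `Ω` is the one that matches the product of the conjugates of a square
root `θ ∉ E` of `x`. -/
theorem coe_norm_eq_prod (x : E) :
    algebraMap F Ω (Algebra.norm F x) = x * s x * t x * s (t x) := by
  have h := congrArg (algebraMap E Ω) (D.norm_eq_prod h2 hsa hsc hta htc x)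
  rw [← IsScalarTower.algebraMap_apply] at h
  rw [h, ← map_mul]
  simp only [map_mul]
  change ((x : E) : Ω) * (res s x : E) * (res t x : E) * ((res s * res t) x : E) = _
  rw [← map_mul, coe_restrictNormalHom, coe_restrictNormalHom, coe_restrictNormalHom]
  rfl

omit hsa hsc hta htc
-- The trace of `[δ]` is the class of the norm in `E`; if it were zero, the norm would be a square
-- in `E` and its class would lie in `V` by Kummer theory.
theorem smul_injective {δ : (E)ˣ}
    (hδ : SqClass.of (Units.map (Algebra.norm F) δ) ∉ V) :
    Function.Injective fun x : MonoidAlgebra (ZMod 2) Gal(E/F) => x • SqClass.of δ := by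
  obtain ⟨s, hsa, hsc⟩ := D.exists_sign_pattern h2 1 0
  obtain ⟨t, hta, htc⟩ := D.exists_sign_pattern h2 0 1
  rw [zsign_zero] at hsc hta
  rw [zsign_one] at hsa htc
  obtain ⟨hs, ht, hst⟩ := D.res_mul_self hsa hsc hta htc
  refine smul_injective_of_trace_ne_zero (fun a => by rw [← two_nsmul, SqClass.two_nsmul_eq_zero])
    hs ht hst (D.gal_cases h2 hsa hsc hta htc) ?_
  simp only [SqClass.single_smul_of, ← SqClass.of_mul]
  rw [Ne, SqClass.of_eq_zero_iff]
  rintro ⟨y, hy⟩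
  apply hδ
  refine (kummer_of_finrank_eq_two (Ω := Ω) h2 D.finrank_eq).2.2 _ (y : E) ?_ (y : E).2
  have h := congrArg (fun z : (E)ˣ => ((z : E) : Ω)) hy
  have h' := congrArg (algebraMap E Ω) (D.norm_eq_prod h2 hsa hsc hta htc δ)
  rw [← IsScalarTower.algebraMap_apply] at h'
  rw [Units.coe_map]
  exact h.trans h'.symm

/-- The span is a copy of the group ring, which has `2⁴` elements. -/
theorem free_and_card {δ : (E)ˣ} (hδ : SqClass.of (Units.map (Algebra.norm F) δ) ∉ V) :
    Module.Free (MonoidAlgebra (ZMod 2) Gal(E/F))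
      (Submodule.span (MonoidAlgebra (ZMod 2) Gal(E/F)) {SqClass.of δ}) ∧
    Nat.card (Submodule.span (MonoidAlgebra (ZMod 2) Gal(E/F)) {SqClass.of δ}) = 16 := by
  obtain ⟨hfd, hfr, -⟩ := kummer_of_finrank_eq_two (Ω := Ω) h2 D.finrank_eq
  have hinj : Function.Injective
    (LinearMap.toSpanSingleton (MonoidAlgebra (ZMod 2) Gal(E/F)) _ (SqClass.of δ)) :=
    D.smul_injective h2 hδ
  rw [← LinearMap.range_toSpanSingleton]
  let e := LinearEquiv.ofInjective _ hinj
  refine ⟨Module.Free.of_equiv e, ?_⟩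
  rw [← Nat.card_congr e.toEquiv,
    Nat.card_congr (MonoidAlgebra.coeffEquiv.trans Finsupp.equivFunOnFinite), Nat.card_fun,
    IsGalois.card_aut_eq_finrank, hfr]
  simp

end BiquadraticData

end Galois

/-! ### From admissible triples to `𝕌₄(𝔽₂)`-extensions -/

namespace AdmissibleTriple

variable {F : Type u} {Ω : Type v} [Field F] [Field Ω] [Algebra F Ω] (t : AdmissibleTriple F Ω)

theorem b_notMem : t.b ∉ t.V := by
  intro h
  have h1 := t.isAdmissiblePair.finrank_eq_two
  have h2 := t.isAdmissiblePair.finrank_sup_eq_three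
  rw [sup_eq_left.2 (by simpa using h)] at h2
  omega

variable [IsGalois F Ω]

theorem smul_mem_W (σ : Gal(Ω/F)) {w : t.Eˣ} (hw : SqClass.of w ∈ t.W) :
    SqClass.of (Units.map (AlgEquiv.restrictNormalHom t.E σ : t.E →* t.E) w) ∈ t.W := by
  rw [← SqClass.single_smul_of]
  exact t.W.smul_mem _ hw

theorem E_le_field {x : Ω} (hx : x ∈ t.E) : x ∈ t.field :=
  IntermediateField.algebraMap_mem (sqrtField t.E Ω (t.W : Set (SqClass t.E))) ⟨x, hx⟩

/-- This is where stability of `W` under `Gal(E/F)` enters: `σ` carries a square root of `w` to one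
of `σ w`. -/
theorem map_mem_field (σ : Gal(Ω/F)) {x : Ω} (hx : x ∈ t.field) : σ x ∈ t.field := by
  change x ∈ sqrtField t.E Ω (t.W : Set (SqClass t.E)) at hx
  induction hx using IntermediateField.adjoin_induction with
  | mem y hy =>
    obtain ⟨w, hw, hy⟩ := hy
    refine mem_sqrtField_of_sq_eq (t.smul_mem_W σ hw) ?_
    rw [← map_pow, hy]
    exact (coe_restrictNormalHom t.E σ w).symm
  | algebraMap x => exact t.E_le_field (coe_restrictNormalHom t.E σ x ▸ Subtype.property _)
  | add x y _ _ hx hy => rw [map_add]; exact add_mem hx hy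
  | inv x _ hx => rw [map_inv₀]; exact inv_mem hx
  | mul x y _ _ hx hy => rw [map_mul]; exact mul_mem hx hy

instance isGalois_field : IsGalois F t.field := by
  have : Normal F t.field := by
    rw [IntermediateField.normal_iff_forall_map_le']
    rintro σ _ ⟨x, hx, rfl⟩
    exact t.map_mem_field σ hx
  exact ⟨⟩

variable [IsSepClosed Ω]

variable (h2 : (2 : Ω) ≠ 0)
include h2

theorem of_norm_notMem {δ : t.Eˣ} (hδ : SqClass.of (Units.map (Algebra.norm F) δ) = t.b) :
    SqClass.of (Units.map (Algebra.norm F) δ) ∉ t.V :=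
  hδ ▸ t.b_notMem

theorem card_W : Nat.card t.W = 16 := by
  obtain ⟨δ, hW, hδ⟩ := t.exists_generator
  obtain ⟨D⟩ := exists_biquadraticData (Ω := Ω) h2 t.isAdmissiblePair.finrank_eq_two
  rw [hW]
  exact (D.free_and_card h2 (t.of_norm_notMem h2 hδ)).2

theorem kummer_W :
    FiniteDimensional t.E (sqrtField t.E Ω (t.W : Set (SqClass t.E))) ∧
    Module.finrank t.E (sqrtField t.E Ω (t.W : Set (SqClass t.E))) = 16 ∧
    ∀ (w : t.Eˣ) (y : Ω), y ^ 2 = algebraMap t.E Ω w →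
      y ∈ sqrtField t.E Ω (t.W : Set (SqClass t.E)) → SqClass.of w ∈ t.W := by
  have hc := t.card_W h2
  have : Finite t.W.toAddSubgroup := Nat.finite_of_card_ne_zero (α := t.W) (by omega)
  have h := kummer_sqrtField (Ω := Ω) h2 t.W.toAddSubgroup
  exact ⟨h.1, h.2.1.trans hc, h.2.2⟩

theorem finrank_field : FiniteDimensional F t.field ∧ Module.finrank F t.field = 64 := by
  obtain ⟨h1, h2, -⟩ := t.kummer_W h2
  obtain ⟨h3, h4, -⟩ := kummer_of_finrank_eq_two (Ω := Ω) ‹_› t.isAdmissiblePair.finrank_eq_two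
  refine ⟨FiniteDimensional.trans F t.E (sqrtField t.E Ω (t.W : Set (SqClass t.E))), ?_⟩
  have := Module.finrank_mul_finrank F t.E (sqrtField t.E Ω (t.W : Set (SqClass t.E)))
  rw [h2, h4] at this
  exact this.symm

/-- An automorphism fixing `E` and the square roots of the conjugates of a generator of `W` fixes
`E(√W)`. -/
theorem fixes_field {δ : t.Eˣ} (hW : t.W = Submodule.span _ {SqClass.of δ}) {σ : Gal(Ω/F)}
    (hE : ∀ x ∈ t.E, σ x = x)
    (hδ : ∀ (τ : Gal(Ω/F)) (y : Ω), y ^ 2 = τ (δ : t.E) → σ y = y) {x : Ω} (hx : x ∈ t.field) :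
    σ x = x := by
  have key : ∀ (w z : t.Eˣ), SqClass.of w = SqClass.of z → ∀ r : Ω, r ^ 2 = algebraMap t.E Ω z →
      σ r = r → ∀ y : Ω, y ^ 2 = algebraMap t.E Ω w → σ y = y := by
    intro w z h r hr hσ y hy
    obtain ⟨k, rfl⟩ := exists_eq_mul_of_of_eq_of h hy hr
    rw [map_mul, hσ]
    congr 1
    exact hE _ (k : t.E).2
  -- The classes all of whose square roots are fixed by `σ` form a subgroup; it contains the
  -- conjugates of `[δ]`, hence all of `W`.
  let P : AddSubgroup (SqClass t.E) :=
    { carrier := {ω | ∀ w : t.Eˣ, SqClass.of w = ω → ∀ y : Ω, y ^ 2 = algebraMap t.E Ω w → σ y = y}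
      zero_mem' := fun w hw => key w 1 (by rw [hw, SqClass.of_one]) 1 (by simp) (map_one σ)
      add_mem' := by
        rintro α β hα hβ w hw
        obtain ⟨a, rfl⟩ := SqClass.of_surjective α
        obtain ⟨b, rfl⟩ := SqClass.of_surjective β
        obtain ⟨ra, hra⟩ := exists_sq_eq_algebraMap h2 (algebraMap t.E Ω a)
        obtain ⟨rb, hrb⟩ := exists_sq_eq_algebraMap h2 (algebraMap t.E Ω b)
        refine key w (a * b) (by rw [hw, SqClass.of_mul]) (ra * rb) ?_ ?_
        · rw [mul_pow, hra, hrb, Units.val_mul, map_mul]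
        · rw [map_mul, hα a rfl ra hra, hβ b rfl rb hrb]
      neg_mem' := by
        intro α hα
        rwa [SqClass.neg_eq_self] }
  have hP : ∀ x : MonoidAlgebra (ZMod 2) Gal(t.E/F), x • SqClass.of δ ∈ P := by
    intro x
    induction x using MonoidAlgebra.induction_linear with
    | zero => rw [zero_smul]; exact P.zero_mem
    | add x y hx hy => rw [add_smul]; exact P.add_mem hx hy
    | single g r =>
      rcases r.two_cases with rfl | rfl
      · rw [MonoidAlgebra.single_zero, zero_smul]; exact P.zero_mem
      · rw [SqClass.single_smul_of]
        intro w hw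
        obtain ⟨τ, rfl⟩ := AlgEquiv.restrictNormalHom_surjective (F := F) (K₁ := t.E) Ω g
        obtain ⟨r, hr⟩ := exists_sq_eq_algebraMap h2 (τ (δ : t.E))
        refine key w _ hw r (hr.trans ?_) (hδ τ r hr)
        exact (coe_restrictNormalHom t.E τ δ).symm
  refine fixes_sqrtField (K := t.E) σ (fun x => hE x x.2) ?_ hx
  intro s hs y hy
  change SqClass.of s ∈ t.W at hs
  rw [hW, Submodule.mem_span_singleton] at hs
  obtain ⟨x, hx⟩ := hs
  exact hP x s hx.symm y hy

/-- The square roots `θ i j` of the conjugates of `δ`, indexed by sign patterns, are permuted up to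
sign. The signs `e` satisfy the wreath product cocycle identity, and the resulting homomorphism to
`𝕌₄(𝔽₂)` is trivial exactly on the automorphisms fixing `E(√W)`. -/
theorem nonempty_mulEquiv : Nonempty (Gal(t.field/F) ≃* Unitriangular 4 (ZMod 2)) := by
  obtain ⟨δ, hW, hδ⟩ := t.exists_generator
  obtain ⟨D⟩ := exists_biquadraticData (Ω := Ω) h2 t.isAdmissiblePair.finrank_eq_two
  obtain ⟨hfd, hfr⟩ := t.finrank_field h2
  obtain ⟨p, hp, hpm⟩ := exists_sign h2 D.hra
  obtain ⟨q, hq, hqm⟩ := exists_sign h2 D.hrc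
  choose l hla hlc using D.exists_sign_pattern h2
  choose θ hθ using fun i j => exists_sq_eq_algebraMap h2 (l i j (δ : t.E))
  have hadd : ∀ i j : ZMod 2, i + j + j = i := by decide
  -- Sign patterns add modulo 2, so both automorphisms agree on `E`.
  have hcong : ∀ (σ : Gal(Ω/F)) (i j : ZMod 2),
      σ (l (i + p σ) (j + q σ) (δ : t.E)) = l i j (δ : t.E) := by
    intro σ i j
    refine D.eq_on (σ := σ * l (i + p σ) (j + q σ)) ?_ ?_ (δ : t.E).2
    · rw [AlgEquiv.mul_apply, hla, hla, map_zsign, hp, zsign_zsign, hadd]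
    · rw [AlgEquiv.mul_apply, hlc, hlc, map_zsign, hq, zsign_zsign, hadd]
  have hθ0 : ∀ i j, θ i j ≠ 0 := by
    intro i j h
    have := hθ i j
    rw [h, zero_pow two_ne_zero, eq_comm, map_eq_zero] at this
    exact δ.ne_zero (Subtype.ext this)
  have hex : ∀ (σ : Gal(Ω/F)) (i j : ZMod 2), ∃ ε, σ (θ (i + p σ) (j + q σ)) = zsign ε (θ i j) := by
    intro σ i j
    apply exists_zsign_of_sq_eq
    rw [← map_pow, hθ, hθ, hcong]
  choose e he using hex
  have hem : ∀ σ τ i j, e (σ * τ) i j = e σ i j + e τ (i + p σ) (j + q σ) := by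
    intro σ τ i j
    refine zsign_injective h2 (hθ0 i j) ?_
    rw [← he, hpm, hqm, AlgEquiv.mul_apply, ← add_assoc, ← add_assoc, he, map_zsign, he,
      zsign_zsign, add_comm]
  let f := Unitriangular.homOfCocycle p q e hpm hqm hem
  have hf : ∀ σ, f σ = 1 ↔ AlgEquiv.restrictNormalHom t.field σ = 1 := by
    intro σ
    rw [Unitriangular.homOfCocycle_eq_one_iff,
      ← map_one (AlgEquiv.restrictNormalHom (F := F) (K₁ := Ω) t.field), restrictNormalHom_eq_iff]
    constructor
    · rintro ⟨h1, h2', h3⟩ x hx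
      refine t.fixes_field h2 hW (fun x hx => D.fixes ?_ ?_ hx) ?_ hx
      · rw [hp, h1, zsign_zero]
      · rw [hq, h2', zsign_zero]
      · intro τ y hy
        have : τ (δ : t.E) = l (p τ) (q τ) (δ : t.E) :=
          D.eq_on (by rw [hp, hla]) (by rw [hq, hlc]) (δ : t.E).2
        rw [this, ← hθ] at hy
        obtain ⟨i, rfl⟩ := exists_zsign_of_sq_eq hy
        have := he σ (p τ) (q τ)
        rw [h1, h2', h3, add_zero, add_zero, zsign_zero] at this
        rw [map_zsign, this]
    · intro h
      have h1 : p σ = 0 := zsign_injective h2 D.ra_ne_zero (by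
        rw [← hp, h _ (t.E_le_field D.ra_mem), zsign_zero, AlgEquiv.one_apply])
      have h2' : q σ = 0 := zsign_injective h2 D.rc_ne_zero (by
        rw [← hq, h _ (t.E_le_field D.rc_mem), zsign_zero, AlgEquiv.one_apply])
      refine ⟨h1, h2', fun i j => zsign_injective h2 (hθ0 i j) ?_⟩
      rw [← he, h1, h2', add_zero, add_zero, zsign_zero, h, AlgEquiv.one_apply]
      refine mem_sqrtField_of_sq_eq (t.smul_mem_W (l i j) (w := δ) ?_) ((hθ i j).trans ?_)
      · rw [hW]; exact Submodule.mem_span_singleton_self _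
      · exact (coe_restrictNormalHom t.E (l i j) δ).symm
  have hsurj : Function.Surjective (AlgEquiv.restrictNormalHom (F := F) (K₁ := Ω) t.field) :=
    AlgEquiv.restrictNormalHom_surjective _
  let f' : Gal(t.field/F) →* Unitriangular 4 (ZMod 2) :=
    MonoidHom.liftOfSurjective _ hsurj ⟨f, fun σ hσ => (hf σ).2 hσ⟩
  have hf' : ∀ σ, f' (AlgEquiv.restrictNormalHom t.field σ) = f σ :=
    MonoidHom.liftOfRightInverse_comp_apply _ _ _ ⟨f, fun σ hσ => (hf σ).2 hσ⟩
  have hinj : Function.Injective f' := by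
    rw [injective_iff_map_eq_one]
    intro g hg
    obtain ⟨σ, rfl⟩ := hsurj g
    rwa [hf', hf] at hg
  have hbij := hinj.bijective_of_nat_card_le (by
    rw [IsGalois.card_aut_eq_finrank, hfr]; exact Unitriangular.card_le)
  exact ⟨MulEquiv.ofBijective f' hbij⟩

/-- The `𝕌₄(𝔽₂)`-extension attached to an admissible triple. -/
def toU4Extension : U4Extension F Ω where
  field := t.field
  finiteDimensional := (t.finrank_field h2).1
  isGalois := t.isGalois_field
  nonempty_mulEquiv := t.nonempty_mulEquiv h2

end AdmissibleTriple

/-- The norm of `δ` from a biquadratic extension `E/F`, with Galois group generated by `g` and `h`,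
is a norm from the quadratic extension `F(r)` fixed by `h`. -/
theorem exists_norm_form {F E : Type*} [Field F] [Field E] [Algebra F E] (h2 : (2 : E) ≠ 0)
    {g h : Gal(E/F)} (hg : g * g = 1) (hh : h * h = 1) (hgh : g * h = h * g)
    (hfix : ∀ x, g x = x → h x = x → ∃ k, algebraMap F E k = x) {N : F} {δ : E}
    (hN : algebraMap F E N = δ * g δ * h δ * (g * h) δ) {v : F} {r : E} (hr0 : r ≠ 0)
    (hr : r ^ 2 = algebraMap F E v) (hhr : h r = r) (hgr : g r = -r) :
    ∃ x y : F, N = x ^ 2 - v * y ^ 2 := by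
  have hg' : ∀ x, g (g x) = x := fun x => DFunLike.congr_fun hg x
  have hh' : ∀ x, h (h x) = x := fun x => DFunLike.congr_fun hh x
  have hgh' : ∀ x, g (h x) = h (g x) := fun x => DFunLike.congr_fun hgh x
  have hm2 : ∀ σ : Gal(E/F), σ 2 = 2 := fun σ => map_ofNat σ 2
  -- `z` is the norm of `δ` to the fixed field of `h`; below, `z = x + y r`, and `N = z * g z` is
  -- its norm to `F`.
  obtain ⟨z, hz⟩ : ∃ z, z = δ * h δ := ⟨_, rfl⟩
  have hhz : h z = z := by rw [hz, map_mul, hh', mul_comm]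
  obtain ⟨x, hx⟩ := hfix ((z + g z) / 2)
    (by rw [map_div₀, map_add, hg', hm2, add_comm])
    (by rw [map_div₀, map_add, ← hgh', hhz, hm2])
  obtain ⟨y, hy⟩ := hfix ((z - g z) / (2 * r))
    (by rw [map_div₀, map_sub, hg', map_mul, hm2, hgr]; field_simp; ring)
    (by rw [map_div₀, map_sub, ← hgh', map_mul, hm2, hhr, hhz])
  refine ⟨x, y, (algebraMap F E).injective ?_⟩
  rw [map_sub, map_mul, map_pow, map_pow, hx, hy, ← hr, hN]
  have : δ * g δ * h δ * (g * h) δ = z * g z := by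
    rw [hz, map_mul, AlgEquiv.mul_apply]; ring
  rw [this]
  field_simp
  ring

/-! ### Characters and generators of a `𝕌₄(𝔽₂)`-extension -/

section Reverse

open Unitriangular

variable {F : Type u} {Ω : Type v} [Field F] [Field Ω] [Algebra F Ω] [IsGalois F Ω]
variable {L : IntermediateField F Ω} [Normal F L] (ρ : Gal(L/F) ≃* Unitriangular 4 (ZMod 2))

/-- The composite of the restriction `Gal(Ω/F) → Gal(L/F)` with `ρ`. -/
noncomputable def liftRep : Gal(Ω/F) →* Unitriangular 4 (ZMod 2) :=
  ρ.toMonoidHom.comp (AlgEquiv.restrictNormalHom L)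

theorem liftRep_surjective : Function.Surjective (liftRep ρ) :=
  ρ.surjective.comp (AlgEquiv.restrictNormalHom_surjective _)

theorem liftRep_eq_iff {σ τ : Gal(Ω/F)} : liftRep ρ σ = liftRep ρ τ ↔ ∀ x ∈ L, σ x = τ x :=
  ρ.injective.eq_iff.trans (restrictNormalHom_eq_iff L σ τ)

theorem coe_symm_apply {σ : Gal(Ω/F)} {M : Unitriangular 4 (ZMod 2)} (h : liftRep ρ σ = M) (x : L) :
    ((ρ.symm M x : L) : Ω) = σ x := by
  rw [← h]
  change ((ρ.symm (ρ _) x : L) : Ω) = _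
  rw [MulEquiv.symm_apply_apply, coe_restrictNormalHom]

theorem map_mem_of_normal (σ : Gal(Ω/F)) {x : Ω} (hx : x ∈ L) : σ x ∈ L :=
  coe_restrictNormalHom L σ ⟨x, hx⟩ ▸ Subtype.property _

/-- Square roots `ra`, `rb`, `rc` in `L` cut out by the characters of `𝕌₄(𝔽₂)`. -/
structure DualData where
  /-- first radicand -/
  a : Fˣ
  /-- second radicand -/
  b : Fˣ
  /-- third radicand -/
  c : Fˣ
  /-- first square root -/
  ra : Ω
  /-- second square root -/
  rb : Ω
  /-- third square root -/
  rc : Ω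
  ra_mem : ra ∈ L
  rb_mem : rb ∈ L
  rc_mem : rc ∈ L
  hra : ra ^ 2 = algebraMap F Ω a
  hrb : rb ^ 2 = algebraMap F Ω b
  hrc : rc ^ 2 = algebraMap F Ω c
  ha : ∀ σ, σ ra = zsign (entry 0 1 (liftRep ρ σ)) ra
  hb : ∀ σ, σ rb = zsign (entry 1 2 (liftRep ρ σ)) rb
  hc : ∀ σ, σ rc = zsign (entry 2 3 (liftRep ρ σ)) rc

/-- An eigenvector for `χ` has a Galois-invariant square, so it is a square root of an element of
`F`. -/
theorem exists_sqrt_of_character [FiniteDimensional F L] (χ : Unitriangular 4 (ZMod 2) → ZMod 2)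
    (hχ : ∀ M N, χ (M * N) = χ M + χ N) :
    ∃ (a : Fˣ) (y : Ω), y ∈ L ∧ y ^ 2 = algebraMap F Ω a ∧
      ∀ σ, σ y = zsign (χ (liftRep ρ σ)) y := by
  obtain ⟨x, hx0, hx⟩ := exists_eigenvector (⊤ : Subgroup Gal(L/F)) (fun g => χ (ρ g))
    (fun σ _ τ _ => by rw [map_mul, hχ])
  have h : ∀ σ : Gal(Ω/F), σ x = zsign (χ (liftRep ρ σ)) (x : Ω) := by
    intro σ
    rw [← coe_restrictNormalHom, hx _ trivial]
    exact map_zsign L.val _ _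
  obtain ⟨k, hk⟩ := (InfiniteGalois.mem_range_algebraMap_iff_fixed ((x : Ω) ^ 2)).2 (by
    intro σ
    rw [map_pow, h, zsign_sq])
  have hk0 : k ≠ 0 := by
    rintro rfl
    rw [map_zero, eq_comm] at hk
    exact hx0 (Subtype.ext (eq_zero_of_pow_eq_zero hk))
  exact ⟨Units.mk0 k hk0, x, x.2, hk.symm, h⟩

theorem nonempty_dualData [FiniteDimensional F L] : Nonempty (DualData ρ) := by
  obtain ⟨a, ra, ha, hra, ha'⟩ := exists_sqrt_of_character ρ (entry 0 1) entry_zero_one_mul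
  obtain ⟨b, rb, hb, hrb, hb'⟩ := exists_sqrt_of_character ρ (entry 1 2) entry_one_two_mul
  obtain ⟨c, rc, hc, hrc, hc'⟩ := exists_sqrt_of_character ρ (entry 2 3) entry_two_three_mul
  exact ⟨⟨a, b, c, ra, rb, rc, ha, hb, hc, hra, hrb, hrc, ha', hb', hc'⟩⟩

/-- Lifts to `Ω` of `ρ⁻¹(E₁₂)`, `ρ⁻¹(E₂₃)` and `ρ⁻¹(E₃₄)`. -/
structure GeneratorLifts where
  /-- lift of `ρ⁻¹(E₁₂)` -/
  s : Gal(Ω/F)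
  /-- lift of `ρ⁻¹(E₂₃)` -/
  u : Gal(Ω/F)
  /-- lift of `ρ⁻¹(E₃₄)` -/
  t : Gal(Ω/F)
  hs : liftRep ρ s = E12
  hu : liftRep ρ u = E23
  ht : liftRep ρ t = E34

theorem nonempty_generatorLifts : Nonempty (GeneratorLifts ρ) := by
  obtain ⟨s, hs⟩ := liftRep_surjective ρ E12
  obtain ⟨u, hu⟩ := liftRep_surjective ρ E23
  obtain ⟨t, ht⟩ := liftRep_surjective ρ E34
  exact ⟨⟨s, u, t, hs, hu, ht⟩⟩

variable {ρ}

namespace GeneratorLifts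

variable (G : GeneratorLifts ρ)
include G

/-- The stabiliser of `y` maps onto `𝕌₄(𝔽₂)` because its image contains the three generators. -/
theorem fixed_of_fixed {y : Ω} (hy : y ∈ L) (h1 : G.s y = y) (h2 : G.u y = y) (h3 : G.t y = y)
    (σ : Gal(Ω/F)) : σ y = y := by
  let H : Subgroup (Unitriangular 4 (ZMod 2)) := (MulAction.stabilizer Gal(Ω/F) y).map (liftRep ρ)
  have hH : H = ⊤ := eq_top_of_elem_mem ⟨G.s, h1, G.hs⟩ ⟨G.u, h2, G.hu⟩ ⟨G.t, h3, G.ht⟩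
  obtain ⟨τ, hτ, h⟩ : liftRep ρ σ ∈ H := hH ▸ Subgroup.mem_top _
  rw [← (liftRep_eq_iff ρ).1 h y hy]
  exact hτ

theorem s_s {y : Ω} (hy : y ∈ L) : G.s (G.s y) = y := by
  refine (liftRep_eq_iff ρ (σ := G.s * G.s) (τ := 1)).1 ?_ y hy
  rw [map_mul, G.hs, map_one, E12_eq, ofEntries_mul, ← ofEntries_zero]
  rfl

theorem t_t {y : Ω} (hy : y ∈ L) : G.t (G.t y) = y := by
  refine (liftRep_eq_iff ρ (σ := G.t * G.t) (τ := 1)).1 ?_ y hy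
  rw [map_mul, G.ht, map_one, E34_eq, ofEntries_mul, ← ofEntries_zero]
  rfl

theorem s_t {y : Ω} (hy : y ∈ L) : G.s (G.t y) = G.t (G.s y) := by
  refine (liftRep_eq_iff ρ (σ := G.s * G.t) (τ := G.t * G.s)).1 ?_ y hy
  rw [map_mul, map_mul, G.hs, G.ht, E12_eq, E34_eq, ofEntries_mul, ofEntries_mul]
  rfl

/-- The product of the conjugates of `θ` under `⟨ρ⁻¹(E₁₂), ρ⁻¹(E₃₄)⟩`. -/
noncomputable def prod (θ : Ω) : Ω := θ * G.s θ * G.t θ * G.s (G.t θ)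

theorem prod_mem {θ : Ω} (hθ : θ ∈ L) : G.prod θ ∈ L :=
  mul_mem (mul_mem (mul_mem hθ (map_mem_of_normal _ hθ)) (map_mem_of_normal _ hθ))
    (map_mem_of_normal _ (map_mem_of_normal _ hθ))

theorem s_prod {θ : Ω} (hθ : θ ∈ L) : G.s (G.prod θ) = G.prod θ := by
  simp only [prod, map_mul, G.s_s hθ, G.s_s (map_mem_of_normal G.t hθ)]
  ring

theorem t_prod {θ : Ω} (hθ : θ ∈ L) : G.t (G.prod θ) = G.prod θ := by
  simp only [prod, map_mul, G.s_t hθ, G.t_t hθ, G.t_t (map_mem_of_normal G.s hθ)]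
  ring

theorem prod_pow (θ : Ω) : G.prod θ ^ 2 = θ ^ 2 * G.s (θ ^ 2) * G.t (θ ^ 2) * G.s (G.t (θ ^ 2)) := by
  simp only [prod, map_pow]
  ring

/-- If `θ` spans the character `M ↦ M₁₄` of the normal abelian subgroup of order `16`, then
`ρ⁻¹(E₂₃)` negates the product of the conjugates of `θ`. -/
theorem u_prod {θ : Ω} (hθ : θ ∈ L)
    (h : ∀ σ, entry 0 1 (liftRep ρ σ) = 0 → entry 2 3 (liftRep ρ σ) = 0 →
      σ θ = zsign (entry 0 3 (liftRep ρ σ)) θ) : G.u (G.prod θ) = -G.prod θ := by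
  -- Since `w² = 1` on `L`, `u w = w (w u w)` there, so the sign of `u` on `w θ` is the (0,3) entry
  -- of the conjugate `w u w`. Among `w = 1, s, t, st` this entry is 1 only for `st`, so the product
  -- changes sign once.
  have key : ∀ w : Gal(Ω/F), liftRep ρ w * liftRep ρ w = 1 →
      entry 0 1 (liftRep ρ (w * G.u * w)) = 0 → entry 2 3 (liftRep ρ (w * G.u * w)) = 0 →
      G.u (w θ) = zsign (entry 0 3 (liftRep ρ (w * G.u * w))) (w θ) := by
    intro w hw h1 h2
    have h3 := h _ h1 h2
    have h4 := (liftRep_eq_iff ρ (σ := G.u * w) (τ := w * (w * G.u * w))).1 (by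
      simp only [map_mul, ← mul_assoc, hw, one_mul]) θ hθ
    rw [AlgEquiv.mul_apply, AlgEquiv.mul_apply, h3, map_zsign] at h4
    exact h4
  have h0 := key 1 (by rw [map_one, one_mul]) (by rw [one_mul, mul_one, G.hu]; rfl)
    (by rw [one_mul, mul_one, G.hu]; rfl)
  rw [one_mul, mul_one, G.hu, show entry 0 3 E23 = 0 from rfl, AlgEquiv.one_apply, zsign_zero] at h0
  have es : liftRep ρ (G.s * G.u * G.s) = ofEntries 0 1 0 1 0 0 := by
    rw [map_mul, map_mul, G.hs, G.hu, E12_eq, E23_eq, ofEntries_mul, ofEntries_mul]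
    rfl
  have hs := key G.s (by
    rw [G.hs, E12_eq, ofEntries_mul, ← ofEntries_zero]; rfl) (by rw [es]; rfl) (by rw [es]; rfl)
  rw [es, entry_zero_three_ofEntries, zsign_zero] at hs
  have et : liftRep ρ (G.t * G.u * G.t) = ofEntries 0 1 0 0 1 0 := by
    rw [map_mul, map_mul, G.ht, G.hu, E34_eq, E23_eq, ofEntries_mul, ofEntries_mul]
    rfl
  have ht := key G.t (by
    rw [G.ht, E34_eq, ofEntries_mul, ← ofEntries_zero]; rfl) (by rw [et]; rfl) (by rw [et]; rfl)
  rw [et, entry_zero_three_ofEntries, zsign_zero] at ht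
  have ew : liftRep ρ (G.s * G.t) = ofEntries 1 0 1 0 0 0 := by
    rw [map_mul, G.ht, G.hs, E34_eq, E12_eq, ofEntries_mul]
    rfl
  have est : liftRep ρ (G.s * G.t * G.u * (G.s * G.t)) = ofEntries 0 1 0 1 1 1 := by
    rw [map_mul, map_mul, ew, G.hu, E23_eq, ofEntries_mul, ofEntries_mul]
    rfl
  have hst := key (G.s * G.t) (by
    rw [ew, ofEntries_mul, ← ofEntries_zero]; rfl) (by rw [est]; rfl) (by rw [est]; rfl)
  rw [est, entry_zero_three_ofEntries, zsign_one, AlgEquiv.mul_apply] at hst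
  simp only [prod, map_mul, h0, hs, ht, hst, mul_neg]

end GeneratorLifts

namespace DualData

variable (d : DualData ρ) (G : GeneratorLifts ρ)

theorem s_ra : G.s d.ra = -d.ra := by
  rw [d.ha, G.hs, show entry 0 1 E12 = 1 from rfl, zsign_one]
theorem s_rb : G.s d.rb = d.rb := by
  rw [d.hb, G.hs, show entry 1 2 E12 = 0 from rfl, zsign_zero]
theorem s_rc : G.s d.rc = d.rc := by
  rw [d.hc, G.hs, show entry 2 3 E12 = 0 from rfl, zsign_zero]
theorem u_ra : G.u d.ra = d.ra := by
  rw [d.ha, G.hu, show entry 0 1 E23 = 0 from rfl, zsign_zero]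
theorem u_rb : G.u d.rb = -d.rb := by
  rw [d.hb, G.hu, show entry 1 2 E23 = 1 from rfl, zsign_one]
theorem u_rc : G.u d.rc = d.rc := by
  rw [d.hc, G.hu, show entry 2 3 E23 = 0 from rfl, zsign_zero]
theorem t_ra : G.t d.ra = d.ra := by
  rw [d.ha, G.ht, show entry 0 1 E34 = 0 from rfl, zsign_zero]
theorem t_rb : G.t d.rb = d.rb := by
  rw [d.hb, G.ht, show entry 1 2 E34 = 0 from rfl, zsign_zero]
theorem t_rc : G.t d.rc = -d.rc := by
  rw [d.hc, G.ht, show entry 2 3 E34 = 1 from rfl, zsign_one]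

theorem ra_ne_zero : d.ra ≠ 0 := ne_zero_of_sq_eq_algebraMap d.hra
theorem rb_ne_zero : d.rb ≠ 0 := ne_zero_of_sq_eq_algebraMap d.hrb
theorem rc_ne_zero : d.rc ≠ 0 := ne_zero_of_sq_eq_algebraMap d.hrc

include G in
/-- An element of `F` with a square root in `L` fixed by `ρ⁻¹(E₁₂)` and `ρ⁻¹(E₃₄)` and negated by
`ρ⁻¹(E₂₃)` has the class of `b`. -/
theorem of_eq_of_b {w : Fˣ} {y : Ω} (hy : y ∈ L) (hw : y ^ 2 = algebraMap F Ω w)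
    (hs : G.s y = y) (hu : G.u y = -y) (ht : G.t y = y) : SqClass.of w = SqClass.of d.b := by
  have h := G.fixed_of_fixed (y := y / d.rb) (div_mem hy d.rb_mem)
    (by rw [map_div₀, hs, d.s_rb]) (by rw [map_div₀, hu, d.u_rb, neg_div_neg_eq])
    (by rw [map_div₀, ht, d.t_rb])
  obtain ⟨z, hz⟩ := (InfiniteGalois.mem_range_algebraMap_iff_fixed _).2 h
  exact of_eq_of_of_eq_mul hw d.hrb (by rw [hz, div_mul_cancel₀ _ d.rb_ne_zero])

variable (h2 : (2 : Ω) ≠ 0)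
include h2

theorem finrank_span : Module.finrank (ZMod 2)
    (Submodule.span (ZMod 2) {SqClass.of d.a, SqClass.of d.c}) = 2 := by
  obtain ⟨G⟩ := nonempty_generatorLifts ρ
  have hra := neg_ne_self_of_two_ne_zero h2 d.ra_ne_zero
  have hrc := neg_ne_self_of_two_ne_zero h2 d.rc_ne_zero
  have key : ∀ (w : Fˣ) (y : Ω) (σ : Gal(Ω/F)), y ^ 2 = algebraMap F Ω w → SqClass.of w = 0 →
      σ y = y := by
    intro w y σ hy hw
    obtain ⟨z, rfl⟩ := exists_eq_mul_of_of_eq_of (t := 1) (y := (1 : Ω))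
      (by rw [hw, SqClass.of_one]) hy (by simp)
    rw [mul_one, AlgEquiv.commutes]
  have hli : LinearIndependent (ZMod 2) ![SqClass.of d.a, SqClass.of d.c] := by
    rw [LinearIndependent.pair_iff]
    intro i j hij
    rw [SqClass.zmod_two_smul, SqClass.zmod_two_smul] at hij
    rcases i.two_cases with rfl | rfl <;> rcases j.two_cases with rfl | rfl <;> simp at hij
    · exact ⟨rfl, rfl⟩
    · exact absurd ((d.t_rc G).symm.trans (key _ _ G.t d.hrc hij)) hrc
    · exact absurd ((d.s_ra G).symm.trans (key _ _ G.s d.hra hij)) hra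
    · rw [← SqClass.of_mul] at hij
      have := key _ (d.ra * d.rc) G.s
        (by rw [mul_pow, d.hra, d.hrc, Units.val_mul, map_mul]) hij
      rw [map_mul, d.s_ra, d.s_rc, neg_mul] at this
      exact absurd this (neg_ne_self_of_two_ne_zero h2 (mul_ne_zero d.ra_ne_zero d.rc_ne_zero))
  have := finrank_span_eq_card hli
  rwa [Matrix.range_cons_cons_empty, Fintype.card_fin] at this

/-- The space `⟨[a], [c]⟩` with its square roots. -/
def biquadraticData {V : Submodule (ZMod 2) (SqClass F)}
    (hV : V = Submodule.span (ZMod 2) {SqClass.of d.a, SqClass.of d.c}) : BiquadraticData F Ω V :=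
  ⟨d.a, d.c, d.ra, d.rc, d.hra, d.hrc, hV, by rw [hV]; exact d.finrank_span h2⟩

/-- `ρ⁻¹(E₂₃)` fixes `√a` and `√c`, hence all of `F(√V)`, but negates `√b`. -/
theorem b_notMem {V : Submodule (ZMod 2) (SqClass F)}
    (hV : V = Submodule.span (ZMod 2) {SqClass.of d.a, SqClass.of d.c}) : SqClass.of d.b ∉ V := by
  intro h
  obtain ⟨G⟩ := nonempty_generatorLifts ρ
  have := (d.biquadraticData h2 hV).fixes (d.u_ra G) (d.u_rc G) (mem_sqrtField_of_sq_eq h d.hrb)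
  rw [d.u_rb] at this
  exact neg_ne_self_of_two_ne_zero h2 d.rb_ne_zero this

end DualData

end Reverse

/-! ### The correspondence: norms, uniqueness and existence of the triple -/

section Correspondence

open Unitriangular

variable {F : Type u} {Ω : Type v} [Field F] [Field Ω] [Algebra F Ω] [IsGalois F Ω]
  [IsSepClosed Ω]

/-- A norm from the biquadratic extension `F(√V)` is a norm from `F(√v)` for `[v] ∈ V`. -/
theorem BiquadraticData.exists_norm_eq {V : Submodule (ZMod 2) (SqClass F)}
    (D : BiquadraticData F Ω V) (h2 : (2 : Ω) ≠ 0) (δ : sqrtField F Ω (V : Set (SqClass F)))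
    {v : Fˣ} (hv : SqClass.of v ∈ V) : ∃ x y : F, Algebra.norm F δ = x ^ 2 - v * y ^ 2 := by
  have h2F : (2 : F) ≠ 0 := fun h => h2 (by rw [← map_ofNat (algebraMap F Ω) 2, h, map_zero])
  obtain ⟨s, hsa, hsc⟩ := D.exists_sign_pattern h2 1 0
  obtain ⟨t, hta, htc⟩ := D.exists_sign_pattern h2 0 1
  rw [zsign_zero] at hsc hta
  rw [zsign_one] at hsa htc
  obtain ⟨hs, ht, hst⟩ := D.res_mul_self hsa hsc hta htc
  have hN := D.norm_eq_prod h2 hsa hsc hta htc δ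
  have hcases := D.gal_cases h2 hsa hsc hta htc
  obtain ⟨r, hr⟩ := exists_sq_eq_algebraMap h2 (algebraMap F Ω v)
  have hrE := mem_sqrtField_of_sq_eq (S := (V : Set (SqClass F))) hv hr
  have h2E : (2 : sqrtField F Ω (V : Set (SqClass F))) ≠ 0 := fun h => h2 (congrArg Subtype.val h)
  generalize AlgEquiv.restrictNormalHom (sqrtField F Ω (V : Set (SqClass F))) s = g at *
  generalize AlgEquiv.restrictNormalHom (sqrtField F Ω (V : Set (SqClass F))) t = h at *
  obtain ⟨r, hr⟩ : ∃ r : sqrtField F Ω (V : Set (SqClass F)), r ^ 2 = algebraMap F _ (v : F) :=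
    ⟨⟨r, hrE⟩, Subtype.ext hr⟩
  have hr0 := ne_zero_of_sq_eq_algebraMap hr
  have hfix : ∀ x, g x = x → h x = x → ∃ k, algebraMap F _ k = x := by
    intro x hg hh
    refine (InfiniteGalois.mem_range_algebraMap_iff_fixed x).2 fun k => ?_
    rcases hcases k with rfl | rfl | rfl | rfl
    · rfl
    · exact hg
    · exact hh
    · rw [AlgEquiv.mul_apply, hh, hg]
  obtain ⟨i, hi⟩ := exists_zsign_of_sq_eq (y := g r) (x := r)
    (by rw [← map_pow, hr, AlgEquiv.commutes])
  obtain ⟨j, hj⟩ := exists_zsign_of_sq_eq (y := h r) (x := r)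
    (by rw [← map_pow, hr, AlgEquiv.commutes])
  rcases i.two_cases with rfl | rfl <;> rcases j.two_cases with rfl | rfl <;>
    simp only [zsign_zero, zsign_one] at hi hj
  · obtain ⟨k, rfl⟩ := hfix r hi hj
    have hk : k ^ 2 = v := (algebraMap F (sqrtField F Ω (V : Set (SqClass F)))).injective (by rw [map_pow, hr])
    have hk0 : k ≠ 0 := by rintro rfl; exact hr0 (map_zero _)
    -- Here `v = k²`, so the form factors; take `x - k y = 1` and `x + k y` equal to the norm.
    refine ⟨(Algebra.norm F δ + 1) / 2, (Algebra.norm F δ - 1) / (2 * k), ?_⟩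
    rw [← hk]
    field_simp
    ring
  · refine exists_norm_form (δ := δ) h2E ht hs hst.symm (fun x h1 h2 => hfix x h2 h1) (hN.trans ?_) hr0 hr
      hi hj
    rw [hst]
    ring
  · exact exists_norm_form h2E hs ht hst hfix hN hr0 hr hj hi
  -- Both `g` and `h` negate `r`, so `g * h` fixes it; use the generators `g` and `g * h`.
  · refine exists_norm_form (h := g * h) (δ := δ) h2E hs ?_ ?_ (fun x h1 h2 => hfix x h1 ?_) (hN.trans ?_)
      hr0 hr ?_ hi
    · rw [mul_assoc, ← mul_assoc h, ← hst, mul_assoc g h h, ht, mul_one, hs]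
    · rw [mul_assoc g h g, hst]
    · rw [hst, AlgEquiv.mul_apply, h1] at h2
      exact h2
    · rw [← mul_assoc g g h, hs, one_mul]
      ring
    · rw [AlgEquiv.mul_apply, hj, map_neg, hi, neg_neg]

/-- An admissible triple is recovered from its field and any isomorphism of the Galois group with
`𝕌₄(𝔽₂)`. -/
theorem AdmissibleTriple.eq_of_dualData (h2 : (2 : Ω) ≠ 0) (t : AdmissibleTriple F Ω)
    {L : IntermediateField F Ω} [Normal F L] {ρ : Gal(L/F) ≃* Unitriangular 4 (ZMod 2)}
    (d : DualData ρ) (hL : t.field = L) :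
    t.b = SqClass.of d.b ∧ t.V = Submodule.span (ZMod 2) {SqClass.of d.a, SqClass.of d.c} ∧
    (t.W : Set (SqClass t.E)) =
      {ω | ∃ w : t.Eˣ, SqClass.of w = ω ∧ ∃ y ∈ L, y ^ 2 = ((w : t.E) : Ω)} := by
  subst hL
  obtain ⟨G⟩ := nonempty_generatorLifts ρ
  obtain ⟨D₀⟩ := exists_biquadraticData (Ω := Ω) h2 t.isAdmissiblePair.finrank_eq_two
  obtain ⟨p, hp, hpm⟩ := exists_sign h2 D₀.hra
  obtain ⟨q, hq, hqm⟩ := exists_sign h2 D₀.hrc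
  -- `E/F` is abelian, as `p` and `q` are additive with commutative values.
  have hcomm : ∀ (σ τ : Gal(Ω/F)), ∀ x ∈ t.E, (σ * τ * σ⁻¹ * τ⁻¹) x = x := by
    intro σ τ x hx
    have hp' := hpm (σ * τ * σ⁻¹ * τ⁻¹) (τ * σ)
    have hq' := hqm (σ * τ * σ⁻¹ * τ⁻¹) (τ * σ)
    rw [show σ * τ * σ⁻¹ * τ⁻¹ * (τ * σ) = σ * τ by group, hpm σ τ, hpm τ σ, add_comm (p τ),
      right_eq_add] at hp'
    rw [show σ * τ * σ⁻¹ * τ⁻¹ * (τ * σ) = σ * τ by group, hqm σ τ, hqm τ σ, add_comm (q τ),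
      right_eq_add] at hq'
    exact D₀.fixes (by rw [hp, hp', zsign_zero]) (by rw [hq, hq', zsign_zero]) hx
  have hcommute : ∀ σ τ : Gal(Ω/F), (∀ x ∈ t.E, σ x = x) → (∀ x ∈ t.E, τ x = x) →
      Commute (liftRep ρ σ) (liftRep ρ τ) := by
    intro σ τ hσ hτ
    change _ * _ = _ * _
    rw [← map_mul, ← map_mul, liftRep_eq_iff]
    intro x hx
    exact commute_on_sqrtField (K := t.E) σ τ (fun y => hσ y y.2) (fun y => hτ y y.2) hx
  have hentry : ∀ σ : Gal(Ω/F), (∀ x ∈ t.E, σ x = x) →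
      entry 0 1 (liftRep ρ σ) = 0 ∧ entry 2 3 (liftRep ρ σ) = 0 := by
    intro σ hσ
    apply entry_eq_zero_of_commute
    · have := hcommute σ _ hσ (hcomm G.s G.u)
      rwa [map_mul, map_mul, map_mul, map_inv, map_inv, G.hs, G.hu] at this
    · have := hcommute σ _ hσ (hcomm G.u G.t)
      rwa [map_mul, map_mul, map_mul, map_inv, map_inv, G.hu, G.ht] at this
  have hraE : d.ra ∈ t.E := mem_of_forall_fixed _ fun σ hσ => by
    rw [d.ha, (hentry σ hσ).1, zsign_zero]
  have hrcE : d.rc ∈ t.E := mem_of_forall_fixed _ fun σ hσ => by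
    rw [d.hc, (hentry σ hσ).2, zsign_zero]
  have hK := (kummer_of_finrank_eq_two (Ω := Ω) h2 t.isAdmissiblePair.finrank_eq_two).2.2
  have : Module.Finite (ZMod 2) t.V :=
    Module.finite_of_finrank_pos (by rw [t.isAdmissiblePair.finrank_eq_two]; omega)
  have hV : t.V = Submodule.span (ZMod 2) {SqClass.of d.a, SqClass.of d.c} := by
    refine (Submodule.eq_of_le_of_finrank_eq ?_ ?_).symm
    · rw [Submodule.span_le]
      rintro _ (rfl | rfl)
      · exact hK _ _ d.hra hraE
      · exact hK _ _ d.hrc hrcE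
    · rw [d.finrank_span h2, t.isAdmissiblePair.finrank_eq_two]
  refine ⟨?_, hV, ?_⟩
  · obtain ⟨δ, hW, hδ⟩ := t.exists_generator
    obtain ⟨θ, hθ⟩ := exists_sq_eq_algebraMap h2 (algebraMap t.E Ω δ)
    have hδW : SqClass.of δ ∈ t.W := by rw [hW]; exact Submodule.mem_span_singleton_self _
    have hθL : θ ∈ t.field := mem_sqrtField_of_sq_eq (K := t.E) hδW hθ
    have hn : G.prod θ ^ 2 = algebraMap F Ω (Units.map (Algebra.norm F) δ : Fˣ) := by
      rw [G.prod_pow, hθ]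
      exact ((d.biquadraticData h2 hV).coe_norm_eq_prod h2 (d.s_ra G) (d.s_rc G) (d.t_ra G)
        (d.t_rc G) δ).symm
    rw [← hδ]
    refine d.of_eq_of_b G (G.prod_mem hθL) hn (G.s_prod hθL) ?_ (G.t_prod hθL)
    -- Were the sign trivial, the product would lie in `F`, so `Nm δ` would be a square,
    -- contradicting `[Nm δ] = t.b ∉ V`.
    obtain ⟨i, hi⟩ := exists_zsign_of_sq_eq (y := G.u (G.prod θ)) (x := G.prod θ)
      (by rw [← map_pow, hn, AlgEquiv.commutes])
    rcases i.two_cases with rfl | rfl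
    · rw [zsign_zero] at hi
      have := G.fixed_of_fixed (G.prod_mem hθL) (G.s_prod hθL) hi (G.t_prod hθL)
      obtain ⟨z, hz⟩ := (InfiniteGalois.mem_range_algebraMap_iff_fixed _).2 this
      exfalso
      apply t.b_notMem
      rw [← hδ, of_eq_of_of_eq_mul (t := 1) (y := (1 : Ω)) hn (by simp) (z := z)
        (by rw [hz, mul_one]), SqClass.of_one]
      exact t.V.zero_mem
    · rwa [zsign_one] at hi
  · ext ω
    constructor
    · intro hω
      obtain ⟨w, rfl⟩ := SqClass.of_surjective ω
      obtain ⟨y, hy⟩ := exists_sq_eq_algebraMap h2 (algebraMap t.E Ω w)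
      exact ⟨w, rfl, y, mem_sqrtField_of_sq_eq hω hy, hy⟩
    · rintro ⟨w, rfl, y, hy, hw⟩
      exact (t.kummer_W h2).2.2 w y hw hy

/-- The type of `W` depends on `V`, so the two modules become comparable only once the spaces are
identified; their descriptions through `L` survive this substitution. -/
theorem AdmissibleTriple.eq_of_W_eq {t t' : AdmissibleTriple F Ω} {L : IntermediateField F Ω}
    (hb : t.b = t'.b) (hV : t.V = t'.V)
    (hW : (t.W : Set (SqClass t.E)) =
      {ω | ∃ w : t.Eˣ, SqClass.of w = ω ∧ ∃ y ∈ L, y ^ 2 = ((w : t.E) : Ω)})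
    (hW' : (t'.W : Set (SqClass t'.E)) =
      {ω | ∃ w : t'.Eˣ, SqClass.of w = ω ∧ ∃ y ∈ L, y ^ 2 = ((w : t'.E) : Ω)}) : t = t' := by
  obtain ⟨b, V, W, _, _, _⟩ := t
  obtain ⟨b', V', W', _, _, _⟩ := t'
  obtain rfl : b = b' := hb
  obtain rfl : V = V' := hV
  obtain rfl : W = W' := SetLike.coe_injective (hW.trans hW'.symm)
  rfl

/-- Both triples are read off from the same `ρ` and the same dual data. -/
theorem AdmissibleTriple.field_injective (h2 : (2 : Ω) ≠ 0) :
    Function.Injective (AdmissibleTriple.field : AdmissibleTriple F Ω → IntermediateField F Ω) := by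
  intro t t' h
  have := (t.finrank_field h2).1
  obtain ⟨ρ⟩ := t.nonempty_mulEquiv h2
  obtain ⟨d⟩ := nonempty_dualData ρ
  obtain ⟨hb, hV, hW⟩ := t.eq_of_dualData h2 d rfl
  obtain ⟨hb', hV', hW'⟩ := t'.eq_of_dualData h2 d h.symm
  exact eq_of_W_eq (hb.trans hb'.symm) (hV.trans hV'.symm) hW hW'

/-- Every `𝕌₄(𝔽₂)`-extension comes from an admissible triple. -/
theorem exists_admissibleTriple_field_eq (h2 : (2 : Ω) ≠ 0) (L : IntermediateField F Ω)
    [FiniteDimensional F L] [IsGalois F L] (ρ : Gal(L/F) ≃* Unitriangular 4 (ZMod 2)) :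
    ∃ t : AdmissibleTriple F Ω, t.field = L := by
  have h2F : (2 : F) ≠ 0 := fun h => h2 (by rw [← map_ofNat (algebraMap F Ω) 2, h, map_zero])
  obtain ⟨G⟩ := nonempty_generatorLifts ρ
  obtain ⟨d⟩ := nonempty_dualData ρ
  obtain ⟨V, hV⟩ : ∃ V, V = Submodule.span (ZMod 2) {SqClass.of d.a, SqClass.of d.c} := ⟨_, rfl⟩
  let D := d.biquadraticData h2 hV
  have hb := d.b_notMem h2 hV
  have hraE : d.ra ∈ sqrtField F Ω (V : Set (SqClass F)) := D.ra_mem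
  have hrcE : d.rc ∈ sqrtField F Ω (V : Set (SqClass F)) := D.rc_mem
  -- The preimage of `A`, on which the entry (0,3) is additive.
  let H : Subgroup Gal(L/F) :=
    { carrier := {g | entry 0 1 (ρ g) = 0 ∧ entry 2 3 (ρ g) = 0}
      one_mem' := by rw [Set.mem_ofPred_eq, map_one]; exact ⟨rfl, rfl⟩
      mul_mem' := by
        rintro g h ⟨h1, h2⟩ ⟨h3, h4⟩
        rw [Set.mem_ofPred_eq, map_mul, entry_zero_one_mul, entry_two_three_mul, h1, h2, h3, h4]
        exact ⟨rfl, rfl⟩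
      inv_mem' := by
        rintro g ⟨h1, h2⟩
        have h3 := entry_zero_one_mul (ρ g) (ρ g⁻¹)
        have h4 := entry_two_three_mul (ρ g) (ρ g⁻¹)
        rw [← map_mul, mul_inv_cancel, map_one, entry_one _ _ (by decide), h1, zero_add] at h3
        rw [← map_mul, mul_inv_cancel, map_one, entry_one _ _ (by decide), h2, zero_add] at h4
        exact ⟨h3.symm, h4.symm⟩ }
  obtain ⟨θ', hθ0, hθ'⟩ := exists_eigenvector H (fun g => entry 0 3 (ρ g)) (by
    rintro σ ⟨h1, h2⟩ τ ⟨h3, h4⟩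
    rw [map_mul, entry_zero_three_mul, h4, h1, mul_zero, zero_mul, add_zero, add_zero])
  obtain ⟨θ, hθL, hθ0, hθ⟩ : ∃ θ ∈ L, θ ≠ 0 ∧ ∀ σ : Gal(Ω/F), entry 0 1 (liftRep ρ σ) = 0 →
      entry 2 3 (liftRep ρ σ) = 0 → σ θ = zsign (entry 0 3 (liftRep ρ σ)) θ := by
    refine ⟨θ', θ'.2, fun h => hθ0 (Subtype.ext h), fun σ h1 h2 => ?_⟩
    rw [← coe_restrictNormalHom, hθ' _ ⟨h1, h2⟩]
    exact map_zsign L.val _ _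
  -- An automorphism fixing `ra` and `rc` maps into `A`, so it sends `θ` to `±θ`.
  have hδE : θ ^ 2 ∈ sqrtField F Ω (V : Set (SqClass F)) := mem_of_forall_fixed _ fun σ hσ => by
    rw [map_pow, hθ σ, zsign_sq]
    · exact zsign_injective h2 d.ra_ne_zero (by rw [← d.ha, zsign_zero, hσ _ hraE])
    · exact zsign_injective h2 d.rc_ne_zero (by rw [← d.hc, zsign_zero, hσ _ hrcE])
  let δ : (sqrtField F Ω (V : Set (SqClass F)))ˣ :=
    Units.mk0 ⟨θ ^ 2, hδE⟩ fun h => pow_ne_zero 2 hθ0 (congrArg Subtype.val h)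
  have hn : G.prod θ ^ 2 = algebraMap F Ω (Units.map (Algebra.norm F) δ : Fˣ) := by
    rw [G.prod_pow]
    exact (D.coe_norm_eq_prod h2 (d.s_ra G) (d.s_rc G) (d.t_ra G) (d.t_rc G) δ).symm
  have hnb : SqClass.of (Units.map (Algebra.norm F) δ) = SqClass.of d.b :=
    d.of_eq_of_b G (G.prod_mem hθL) hn (G.s_prod hθL) (G.u_prod hθL hθ) (G.t_prod hθL)
  have hfr : Module.finrank (ZMod 2) V = 2 := D.finrank_eq
  have : Module.Finite (ZMod 2) V := Module.finite_of_finrank_pos (by omega)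
  have hsup : Module.finrank (ZMod 2)
      (V ⊔ Submodule.span (ZMod 2) {SqClass.of d.b} : Submodule (ZMod 2) (SqClass F)) = 3 := by
    have h0 : SqClass.of d.b ≠ 0 := fun h => hb (h ▸ V.zero_mem)
    have hinf : V ⊓ Submodule.span (ZMod 2) {SqClass.of d.b} = ⊥ := by
      rw [← disjoint_iff, Submodule.disjoint_span_singleton' h0]
      exact hb
    have := Submodule.finrank_sup_add_finrank_inf_eq V (Submodule.span (ZMod 2) {SqClass.of d.b})
    rw [hinf, finrank_bot, finrank_span_singleton h0, hfr] at this
    simpa using this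
  have hsplit : ∀ b v : Fˣ, SqClass.of b = SqClass.of d.b → SqClass.of v ∈ V →
      QuaternionSplit (b : F) (v : F) := by
    intro b v hb' hv
    obtain ⟨f, hf⟩ := (SqClass.of_eq_of_iff _ _).1 (hb'.trans hnb.symm)
    obtain ⟨x, y, h⟩ := D.exists_norm_eq h2 δ hv
    refine quaternionSplit_of_eq h2F b.ne_zero v.ne_zero (x := x * f) (y := y * f) ?_
    rw [hf, Units.val_mul, Units.val_pow_eq_pow_val, Units.coe_map]
    exact (congrArg (· * (f : F) ^ 2) h).trans (by ring)
  let t : AdmissibleTriple F Ω :=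
    { b := SqClass.of d.b
      V := V
      W := Submodule.span _ {SqClass.of δ}
      isAdmissiblePair := ⟨hfr, hsup, hsplit⟩
      free := (D.free_and_card h2 (by rw [hnb]; exact hb)).1
      exists_generator := ⟨δ, rfl, hnb⟩ }
  refine ⟨t, IntermediateField.eq_of_le_of_finrank_le ?_ ?_⟩
  · intro x hx
    refine mem_of_forall_fixed L fun σ hσ => ?_
    refine t.fixes_field h2 (δ := δ) rfl
      (fun x hx => D.fixes (hσ _ d.ra_mem) (hσ _ d.rc_mem) hx) ?_ hx
    intro τ y hy
    have hy : y ^ 2 = (τ θ) ^ 2 := hy.trans (map_pow τ θ 2)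
    obtain ⟨i, rfl⟩ := exists_zsign_of_sq_eq hy
    rw [map_zsign, hσ _ (map_mem_of_normal τ hθL)]
  · rw [(t.finrank_field h2).2, ← IsGalois.card_aut_eq_finrank, Nat.card_congr ρ.toEquiv]
    exact Unitriangular.card_le

theorem U4Extension.ext_field {L L' : U4Extension F Ω} (h : L.field = L'.field) : L = L' := by
  cases L; cases L'; cases h; rfl

end Correspondence

/-! ### The bijection -/

theorem mainTheorem1 {F : Type u} [Field F] (hF : ringChar F ≠ 2)
    {Ω : Type v} [Field Ω] [Algebra F Ω] [IsSepClosure F Ω] :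
    ∃ Φ : AdmissibleTriple F Ω ≃ U4Extension F Ω,
      (∀ t : AdmissibleTriple F Ω, (Φ t).field = t.field) ∧
      (∀ (L : U4Extension F Ω) (ρ : Gal(L.field/F) ≃* Unitriangular 4 (ZMod 2)),
        IsKummerTriple L.field ρ (Φ.symm L)) := by
  have : IsSepClosed Ω := IsSepClosure.sep_closed F
  have h2F : (2 : F) ≠ 0 := Ring.two_ne_zero hF
  have h2 : (2 : Ω) ≠ 0 := fun h =>
    h2F ((algebraMap F Ω).injective (by rw [map_ofNat, h, map_zero]))
  let Φ : AdmissibleTriple F Ω ≃ U4Extension F Ω :=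
    Equiv.ofBijective (fun t => t.toU4Extension h2)
      ⟨fun t t' h => AdmissibleTriple.field_injective h2 (congrArg U4Extension.field h), by
        intro L
        have := L.finiteDimensional
        have := L.isGalois
        obtain ⟨ρ⟩ := L.nonempty_mulEquiv
        obtain ⟨t, ht⟩ := exists_admissibleTriple_field_eq h2 L.field ρ
        exact ⟨t, U4Extension.ext_field ht⟩⟩
  have hΦ : ∀ t, (Φ t).field = t.field := fun t => rfl
  refine ⟨Φ, hΦ, fun L ρ => ?_⟩
  have := L.finiteDimensional
  have := L.isGalois
  have hL : (Φ.symm L).field = L.field := by rw [← hΦ, Equiv.apply_symm_apply]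
  obtain ⟨d⟩ := nonempty_dualData ρ
  obtain ⟨G⟩ := nonempty_generatorLifts ρ
  obtain ⟨hb, hV, hW⟩ := (Φ.symm L).eq_of_dualData h2 d hL
  refine ⟨⟨d.a, d.b, d.c, ⟨d.ra, d.ra_mem⟩, ⟨d.rb, d.rb_mem⟩, ⟨d.rc, d.rc_mem⟩, Subtype.ext d.hra,
    Subtype.ext d.hrb, Subtype.ext d.hrc, ?_, hb, hV⟩, hW⟩
  refine ⟨⟨?_, ?_, ?_⟩, ⟨?_, ?_, ?_⟩, ?_, ?_, ?_⟩ <;> apply Subtype.ext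
  · exact (coe_symm_apply ρ G.hs _).trans (d.s_ra G)
  · exact (coe_symm_apply ρ G.hs _).trans (d.s_rb G)
  · exact (coe_symm_apply ρ G.hs _).trans (d.s_rc G)
  · exact (coe_symm_apply ρ G.hu _).trans (d.u_ra G)
  · exact (coe_symm_apply ρ G.hu _).trans (d.u_rb G)
  · exact (coe_symm_apply ρ G.hu _).trans (d.u_rc G)
  · exact (coe_symm_apply ρ G.ht _).trans (d.t_ra G)
  · exact (coe_symm_apply ρ G.ht _).trans (d.t_rb G)
  · exact (coe_symm_apply ρ G.ht _).trans (d.t_rc G)
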